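/- **Setting.** For rank $d\ge 4$ put $\eta=\frac{d-1}{4}$ and $\iota(d)=2^{d-1}\,\Gamma\!\big(\tfrac{d+1}{d-1}\big)^{d-1}$. Consider the rank-$d$ $U(1)$ tensorial field theory with kinetic kernel $\vec p^{\,2\eta}+m^{2\eta}$, $\vec p^{\,2\eta}=\sum_{i=1}^d|p_i|^{2\eta}$, $\vec p\in\mathbb Z^d$, sharp cutoff $\vec p^{\,2\eta}\le\Lambda^{2\eta}$ and quartic melonic interactions with coupling $\lambda=\frac{g}{d\,\iota(d)}$. Write $M=m^{2\eta}/\Lambda^{2\eta}$. Its melonic self energy is $\Sigma(\vec p)=\sum_i\tau(p_i)$, where $\tau:\mathbb Z\to\mathbb R$ solves $$\tau(p)=-2\lambda\sum_{\vec q\in\mathbb Z^d,\ q_1=p,\ \vec q^{\,2\eta}\le\Lambda^{2\eta}}\frac{1}{\vec q^{\,2\eta}+m^{2\eta}-\sum_i\tau(q_i)}$$ (and likewise with $q_i=p$ for every colour $i$) with all these denominators positive. The dimensionless melonic effective mass is $M-d\,\tau(0)/\Lambda^{2\eta}$. For real $g\ne0$ and $M$ let $$a=\frac{1+M+2g}{2g},\qquad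 \Delta=-\Big(\frac{M}{2g}+1\Big)e^{-a},\qquad u^\star=\big(e^{-W(\Delta)-a}-1\big)^{-1},$$ where $W$ is one of the real Lambert branches $W_0$ (on $[-1/e,\infty)$) or $W_{-1}$ (on $[-1/e,0)$). The interior of the perturbative region is the set of $(g,M)$ with $g\neq0$, $M\ne-1$, $\Delta>-1/e$ (and also $\Delta<0$ for the branch $W_{-1}$). A triple $(\beta_d,\beta_{M,d},\gamma_d)$ is a rank-$d$ flow at $(g,M)$ if for all $\Lambda>0$ the Callan–Symanzik equations $$\Big(\Lambda\partial_\Lambda+\beta_d\,\partial_g+(\Lambda^{2\eta}\beta_{M,d}+2\eta m^{2\eta})\,\partial_{m^{2\eta}}-\gamma_d\Big)F=0$$ hold at $m^{2\eta}=M\Lambda^{2\eta}$ both for $F=\Gamma^{(2)}(\vec 0)=\Lambda^{2\eta}u^\star(g,m^{2\eta}/\Lambda^{2\eta})$ and for the ratio $F=\gamma^{(4)}/Z_{\rm eff}=4\lambda\big/\big(1-\frac{2\lambda\iota(d)}{1+m^{2\eta}/\Lambda^{2\eta}}\big)$ fixed by the zero-momentum Ward identity. A large-$d$ flow is a sequence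 of such triples (for all large $d$) for which $\beta_d\to\beta$ and $\beta_{M,d}/(4\eta)\to b$ converge as $d\to\infty$. A point of the interior region is a large-$d$ fixed point if some large-$d$ flow there, with any anomalous dimensions $\gamma_d$, has $\beta=b=0$. **Theorem.** 1. Let $g,M>0$. For all $d\ge4$, $\Lambda>0$ the melonic self energy exists and is unique; $(g,M)$ lies in the interior region of the branch $W_{-1}$; and the melonic effective mass tends to $u^\star(g,M)$ (branch $W_{-1}$) as first $\Lambda\to\infty$ and then $d\to\infty$: for every $\varepsilon>0$, for all large $d$, for all large $\Lambda$ (depending on $d$), the two differ by less than $\varepsilon$. 2. For $g\ne0$ and real $M$, $u$: one has $u\notin[-1,0]$ and $u=(M+2g)-2g\,u\ln\frac{1+u}{u}$ if and only if $u=u^\star(g,M)$ for one of the branches whose domain contains $\Delta$. 3. On the domain of each branch, $We^{W}=x$, and $1+W(x)=0$ if and only if $x=-1/e$. 4. For each branch, $u^\star$ is differentiable in $(g,M)$ on the interior region, and at each of its points the large-$d$ flow with $\gamma_d=0$ exists and its limits are uniquely determined: $$b=g\,e^{W(\Delta)+a}\,(1+W(\Delta)),\qquad \beta=\frac{2g^3}{(1+M)^2}\,e^{W(\Delta)+a}\,(1+W(\Delta)).$$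 5. For each branch, there is no large-$d$ fixed point in the interior of the perturbative region; in particular there is no isolated one. -/

import Mathlib

/-! The rank `d` Abelian tensorial group field theory with quartic melonic interactions, its
melonic self energy, its large rank effective mass and the Callan-Symanzik equations. Throughout,
`g` is the rescaled coupling, `M` stands for the dimensionless mass parameter
`m^{2η} / Λ^{2η}` (a single real number, of either sign), and `μ` for the dimensionful `m^{2η}`. -/

namespace MelonicTGFT

open Filter Topology

noncomputable section

/-! ### The model at rank `d` -/

/-- The exponent `η = (d - 1) / 4` for which the rank `d` model is just-renormalizable. -/
def eta (d : ℕ) : ℝ := ((d : ℝ) - 1) / 4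

/-- `ι(d) = 2^{d-1} Γ((d+1)/(d-1))^{d-1}`, that is
`2^{d-1} ∫_{(ℝ₊)^{d-1}} δ(1 - ∑ x_i^{2η}) dx`. -/
def iota (d : ℕ) : ℝ := 2 ^ (d - 1) * Real.Gamma (((d : ℝ) + 1) / ((d : ℝ) - 1)) ^ (d - 1)

/-- The bare coupling `λ = g / (d ι(d))` in terms of the rescaled coupling `g`. -/
def bareCoupling (d : ℕ) (g : ℝ) : ℝ := g / (d * iota d)

/-- `p^{2η} = ∑ i, |p i|^{2η}` for a momentum `p ∈ ℤ^d`. -/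
def momentumPow (d : ℕ) (p : Fin d → ℤ) : ℝ := ∑ i, |(p i : ℝ)| ^ (2 * eta d)

/-- The melonic two-point function `Γ⁽²⁾(p) = p^{2η} + m^{2η} - ∑ i, τ(p i)`. -/
def twoPoint (d : ℕ) (μ : ℝ) (τ : ℤ → ℝ) (p : Fin d → ℤ) : ℝ :=
  momentumPow d p + μ - ∑ i, τ (p i)

open Classical in
/-- `τ` is the melonic self energy (per colour) of the rank `d` model with sharp cutoff `Λ`,
bare mass parameter `m^{2η} = M Λ^{2η}` and bare coupling `λ = g / (d ι(d))`:
it solves the closed melonic Schwinger-Dyson equation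
`τ(p) = -2λ ∑_q δ_{p, q_i} Θ(Λ^{2η} - q^{2η}) / Γ⁽²⁾(q)` (for each colour `i`), and the resulting
two-point function is positive below the cutoff. The sum has finitely many nonzero terms. -/
def IsMelonicSelfEnergy (d : ℕ) (Λ g M : ℝ) (τ : ℤ → ℝ) : Prop :=
  (∀ (i : Fin d) (p : ℤ), τ p = -2 * bareCoupling d g *
    ∑' q : Fin d → ℤ, if q i = p ∧ momentumPow d q ≤ Λ ^ (2 * eta d)
      then 1 / twoPoint d (M * Λ ^ (2 * eta d)) τ q else 0) ∧
  ∀ q : Fin d → ℤ, momentumPow d q ≤ Λ ^ (2 * eta d) →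
    0 < twoPoint d (M * Λ ^ (2 * eta d)) τ q

/-- The dimensionless melonic effective mass `Λ^{-2η} Γ⁽²⁾(0) = M - d τ(0) / Λ^{2η}`. -/
def melonicEffectiveMass (d : ℕ) (Λ M : ℝ) (τ : ℤ → ℝ) : ℝ :=
  M - d * τ 0 / Λ ^ (2 * eta d)

/-! ### The real branches of the Lambert function and the large rank effective mass -/

/-- The two real branches `W₀` and `W₋₁` of the Lambert function. -/
inductive LambertBranch
  | principal
  | lower

/-- The range of a branch: `W₀ ≥ -1` and `W₋₁ ≤ -1`. -/
def lambertRange : LambertBranch → Set ℝ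
  | .principal => Set.Ici (-1)
  | .lower => Set.Iic (-1)

/-- The domain of a branch: `[-1/e, ∞)` for `W₀` and `[-1/e, 0)` for `W₋₁`. -/
def lambertDomain : LambertBranch → Set ℝ
  | .principal => Set.Ici (-Real.exp (-1))
  | .lower => Set.Ico (-Real.exp (-1)) 0

/-- The branch of the Lambert function: on `lambertDomain k`, `lambertW k x` is the element `w` of
`lambertRange k` with `w e^w = x`. -/
def lambertW (k : LambertBranch) (x : ℝ) : ℝ :=
  Function.invFunOn (fun w : ℝ => w * Real.exp w) (lambertRange k) x

/-- `a = (1 + M + 2g) / (2g)`. -/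
def expo (g M : ℝ) : ℝ := (1 + M + 2 * g) / (2 * g)

/-- `Δ = -(M / (2g) + 1) e^{-a}`. -/
def Delta (g M : ℝ) : ℝ := -(M / (2 * g) + 1) * Real.exp (-expo g M)

/-- The resummed large rank effective mass `u⋆ = (e^{-W(Δ) - a} - 1)⁻¹`, on either branch. -/
def uStar (k : LambertBranch) (g M : ℝ) : ℝ :=
  (Real.exp (-lambertW k (Delta g M) - expo g M) - 1)⁻¹

/-- The interior of the perturbative region: the points `(g, M)` with nonzero coupling
(so that `Δ` makes sense), `1 + M ≠ 0` (so that the Ward relation makes sense), and `Δ` in the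
interior of the domain of the branch: `Δ > -1/e` for `W₀` and `-1/e < Δ < 0` for `W₋₁`. -/
def interiorRegion (k : LambertBranch) : Set (ℝ × ℝ) :=
  {x | x.1 ≠ 0 ∧ 1 + x.2 ≠ 0 ∧ Delta x.1 x.2 ∈ interior (lambertDomain k)}

/-! ### The renormalization group flow -/

/-- The zero momentum two-point function `Γ⁽²⁾(0) = Λ^{2η} u⋆(g, m^{2η} / Λ^{2η})`. -/
def gammaTwo (k : LambertBranch) (d : ℕ) (Λ g μ : ℝ) : ℝ :=
  Λ ^ (2 * eta d) * uStar k g (μ / Λ ^ (2 * eta d))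

/-- The ratio `γ⁽⁴⁾ / Z_eff` of the zero momentum four-point function to the effective wave
function, which the zero momentum Ward identity fixes to be
`4λ / (1 - 2λ ι(d) / (1 + m^{2η} / Λ^{2η}))`, with `λ = g / (d ι(d))`. -/
def wardRatio (d : ℕ) (Λ g μ : ℝ) : ℝ :=
  4 * bareCoupling d g /
    (1 - 2 * bareCoupling d g * iota d / (1 + μ / Λ ^ (2 * eta d)))

/-- The Callan-Symanzik derivative `Λ ∂_Λ + β ∂_g + β_m ∂_{m^{2η}}`, where
`β_m = Λ^{2η} b + 2η m^{2η}` and `b` is the beta function of the dimensionless mass. -/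
def csDerivative (d : ℕ) (β b : ℝ) (F : ℝ → ℝ → ℝ → ℝ) (Λ g μ : ℝ) : ℝ :=
  Λ * deriv (fun Λ' => F Λ' g μ) Λ + β * deriv (fun g' => F Λ g' μ) g +
    (Λ ^ (2 * eta d) * b + 2 * eta d * μ) * deriv (fun μ' => F Λ g μ') μ

/-- `β`, `b`, `γ` are values at `(g, M)` of the rank `d` beta functions of the rescaled coupling
and of the dimensionless mass and of the anomalous dimension: the Callan-Symanzik
equations hold for `Γ⁽²⁾(0)` (weight `γ`) and for `γ⁽⁴⁾ / Z_eff` (weight `2γ - γ = γ`, as `γ⁽⁴⁾` has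
weight `2γ` and `Z_eff` has weight `γ`). -/
def IsFlow (k : LambertBranch) (d : ℕ) (g M β b γ : ℝ) : Prop :=
  ∀ Λ : ℝ, 0 < Λ →
    csDerivative d β b (gammaTwo k d) Λ g (M * Λ ^ (2 * eta d)) =
      γ * gammaTwo k d Λ g (M * Λ ^ (2 * eta d)) ∧
    csDerivative d β b (wardRatio d) Λ g (M * Λ ^ (2 * eta d)) =
      γ * wardRatio d Λ g (M * Λ ^ (2 * eta d))

/-- `(B, b)` are the large rank limits at `(g, M)` of the beta functions along anomalous
dimensions `γ_d`: `β_d → B`, and `b_d / (4η) → b` (the mass beta function grows like `4η = d - 1`). -/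
def IsLargeRankBeta (k : LambertBranch) (γ : ℕ → ℝ) (g M B b : ℝ) : Prop :=
  ∃ β β' : ℕ → ℝ, (∀ᶠ d in atTop, IsFlow k d g M (β d) (β' d) (γ d)) ∧
    Tendsto β atTop (𝓝 B) ∧ Tendsto (fun d => β' d / (4 * eta d)) atTop (𝓝 b)

/-- The fixed points of the large rank flow in the interior of the perturbative region: both
limiting beta functions vanish, with no condition on the anomalous dimension. -/
def largeRankFixedPoints (k : LambertBranch) : Set (ℝ × ℝ) :=
  {x | x ∈ interiorRegion k ∧ ∃ γ : ℕ → ℝ, IsLargeRankBeta k γ x.1 x.2 0 0}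

/-- An isolated point of a subset of the plane. -/
def IsIsolatedPoint (S : Set (ℝ × ℝ)) (x : ℝ × ℝ) : Prop :=
  x ∈ S ∧ ∃ U ∈ 𝓝 x, U ∩ S = {x}

end

end MelonicTGFT

namespace MelonicTGFT

open Filter Topology
open scoped Pointwise

/-! ### The real Lambert branches -/

/-! Self energy. With `σ = -τ ≥ 0` the Schwinger-Dyson equation is a fixed point problem for an
order-reversing map on a finite lattice sum. Its square is monotone, so in `ENNReal` a least fixed
point of the square exists, which gives a two-cycle of the map. Because the bare term is strictly
positive, scaling an argument by at most `t > 1` moves the image by strictly less than `t`.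
Comparing the largest ratio of two solutions therefore collapses two-cycles and gives uniqueness
(`sdMap_fixed_unique`, `exists_sdMap_fixed`).

Limit. The exponent is `2η = n / 2` with `n = d - 1`, so the lattice points with `∑ |q_i|^{2η} ≤ R`
number about `ι(d) R² / 2`. Layer-cake summation turns this into `tendsto_sum_latticeBall_inv`,
where the logarithm of the mass equation appears. At large rank a momentum below the cutoff has few
large components, so its self energy is close to `d σ(0)` (`IsSliceSolution.sum_zero_sub_le`).
Comparing the effective mass with a solution `v` of the mass equation then gives convergence. The
substitution `L = log ((1 + u) / u)` turns that equation into `L + a = (M / (2g) + 1) e^L`, a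
Lambert equation for `w = -(L + a)` (`massEquation_iff`).

Flow. At `m^{2η} = M Λ^{2η}` the cutoff drops out of the Callan-Symanzik equations, leaving two
equations linear in `β`, `b`, `γ` (`isFlow_iff`). For `γ = 0` they are solved and the limit is
taken. For a fixed point the Ward equation forces `γ_d → 0`. The mass equation divided by `4η` then
leaves only its canonical term `u⋆ / 2`, which would have to vanish, whereas `u⋆` is the inverse of
a nonzero number. Neither step uses a sign of the coupling or a particular branch. -/

theorem neg_exp_neg_one_le_mul_exp (w : ℝ) : -Real.exp (-1) ≤ w * Real.exp w := by
  -- The tangent bound reads `-w ≤ exp (-1 - w)`; multiplying by `exp w` gives the claim.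
  have h := Real.add_one_le_exp (-1 - w)
  have h2 : Real.exp (-1) = Real.exp (-1 - w) * Real.exp w := by rw [← Real.exp_add]; ring_nf
  rw [h2]
  nlinarith [Real.exp_pos w]

theorem mul_exp_eq_neg_exp_neg_one_iff (w : ℝ) : w * Real.exp w = -Real.exp (-1) ↔ w = -1 := by
  refine ⟨fun hw => ?_, fun hw => by rw [hw]; ring⟩
  by_contra hne
  have h := Real.add_one_lt_exp (x := -1 - w) (fun h0 => hne (by linarith))
  have h2 : Real.exp (-1) = Real.exp (-1 - w) * Real.exp w := by rw [← Real.exp_add]; ring_nf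
  rw [h2] at hw
  nlinarith [Real.exp_pos w]

theorem hasStrictDerivAt_mul_exp (w : ℝ) :
    HasStrictDerivAt (fun w : ℝ => w * Real.exp w) ((1 + w) * Real.exp w) w := by
  have h := (hasStrictDerivAt_id w).mul (Real.hasStrictDerivAt_exp w)
  rwa [show 1 * Real.exp w + id w * Real.exp w = (1 + w) * Real.exp w by simp only [id]; ring] at h

theorem continuous_mul_exp : Continuous (fun w : ℝ => w * Real.exp w) := by fun_prop

theorem strictMonoOn_mul_exp : StrictMonoOn (fun w : ℝ => w * Real.exp w) (Set.Ici (-1)) := by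
  refine strictMonoOn_of_deriv_pos (convex_Ici _) continuous_mul_exp.continuousOn fun w hw => ?_
  rw [(hasStrictDerivAt_mul_exp w).hasDerivAt.deriv]
  rw [interior_Ici, Set.mem_Ioi] at hw
  exact mul_pos (by linarith) (Real.exp_pos w)

theorem strictAntiOn_mul_exp : StrictAntiOn (fun w : ℝ => w * Real.exp w) (Set.Iic (-1)) := by
  refine strictAntiOn_of_deriv_neg (convex_Iic _) continuous_mul_exp.continuousOn fun w hw => ?_
  rw [(hasStrictDerivAt_mul_exp w).hasDerivAt.deriv]
  rw [interior_Iic, Set.mem_Iio] at hw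
  exact mul_neg_of_neg_of_pos (by linarith) (Real.exp_pos w)

theorem injOn_mul_exp (k : LambertBranch) :
    Set.InjOn (fun w : ℝ => w * Real.exp w) (lambertRange k) := by
  cases k
  · exact strictMonoOn_mul_exp.injOn
  · exact strictAntiOn_mul_exp.injOn

theorem mul_exp_mem_lambertDomain {k : LambertBranch} {w : ℝ} (hw : w ∈ lambertRange k) :
    w * Real.exp w ∈ lambertDomain k := by
  cases k
  · exact neg_exp_neg_one_le_mul_exp w
  · refine ⟨neg_exp_neg_one_le_mul_exp w, ?_⟩
    have : w ≤ -1 := hw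
    exact mul_neg_of_neg_of_pos (by linarith) (Real.exp_pos w)

theorem surjOn_mul_exp (k : LambertBranch) :
    Set.SurjOn (fun w : ℝ => w * Real.exp w) (lambertRange k) (lambertDomain k) := by
  have hm : (-1 : ℝ) * Real.exp (-1) = -Real.exp (-1) := by ring
  intro x hx
  cases k
  · have h0 : (-1 : ℝ) ≤ max x 0 := le_trans (by norm_num) (le_max_right _ _)
    have h1 : x ≤ max x 0 * Real.exp (max x 0) :=
      (le_max_left _ _).trans
        (le_mul_of_one_le_right (le_max_right _ _) (Real.one_le_exp (le_max_right _ _)))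
    obtain ⟨w, hw, hwx⟩ := intermediate_value_Icc h0 continuous_mul_exp.continuousOn
      (show x ∈ Set.Icc _ _ from ⟨by rw [hm]; exact hx, h1⟩)
    exact ⟨w, hw.1, hwx⟩
  · obtain ⟨hx1, hx2⟩ := hx
    -- With `-x * t ≥ 2` and `exp t ≥ t² / 2`, one gets `-x * exp t ≥ t`, so `-t` is a left endpoint
    -- for the intermediate value theorem.
    set t := max 1 (2 / (-x)) with ht
    have ht1 : 1 ≤ t := le_max_left _ _
    have ht2 : 2 / (-x) ≤ t := le_max_right _ _
    rw [div_le_iff₀ (by linarith)] at ht2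
    have hq := Real.quadratic_le_exp_of_nonneg (x := t) (by linarith)
    have h1 : x ≤ -t * Real.exp (-t) := by
      rw [Real.exp_neg, ← div_eq_mul_inv, le_div_iff₀ (Real.exp_pos t)]
      nlinarith
    obtain ⟨w, hw, hwx⟩ := intermediate_value_Icc' (show -t ≤ -1 by linarith)
      continuous_mul_exp.continuousOn
      (show x ∈ Set.Icc _ _ from ⟨by rw [hm]; exact hx1, h1⟩)
    exact ⟨w, hw.2, hwx⟩

theorem lambertW_mem {k : LambertBranch} {x : ℝ} (hx : x ∈ lambertDomain k) :
    lambertW k x ∈ lambertRange k :=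
  Function.invFunOn_mem (surjOn_mul_exp k hx)

theorem lambertW_mul_exp {k : LambertBranch} {x : ℝ} (hx : x ∈ lambertDomain k) :
    lambertW k x * Real.exp (lambertW k x) = x :=
  Function.invFunOn_eq (f := fun w : ℝ => w * Real.exp w) (surjOn_mul_exp k hx)

theorem lambertW_apply_mul_exp {k : LambertBranch} {w : ℝ} (hw : w ∈ lambertRange k) :
    lambertW k (w * Real.exp w) = w :=
  injOn_mul_exp k (lambertW_mem (mul_exp_mem_lambertDomain hw)) hw
    (lambertW_mul_exp (mul_exp_mem_lambertDomain hw))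

theorem one_add_lambertW_eq_zero_iff {k : LambertBranch} {x : ℝ} (hx : x ∈ lambertDomain k) :
    1 + lambertW k x = 0 ↔ x = -Real.exp (-1) := by
  have h := mul_exp_eq_neg_exp_neg_one_iff (lambertW k x)
  rw [lambertW_mul_exp hx] at h
  rw [h]
  constructor <;> intro h <;> linarith

theorem neg_exp_neg_one_lt_of_mem_interior {k : LambertBranch} {x : ℝ}
    (hx : x ∈ interior (lambertDomain k)) : -Real.exp (-1) < x := by
  cases k
  · simpa [lambertDomain] using hx
  · simp only [lambertDomain, interior_Ico, Set.mem_Ioo] at hx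
    exact hx.1

theorem one_add_lambertW_ne_zero {k : LambertBranch} {x : ℝ}
    (hx : x ∈ interior (lambertDomain k)) : 1 + lambertW k x ≠ 0 := fun h =>
  (neg_exp_neg_one_lt_of_mem_interior hx).ne'
    ((one_add_lambertW_eq_zero_iff (interior_subset hx)).1 h)

/-- Inverse function theorem: inside the domain the value of `W` is not `-1`, so the range of the
branch is a neighbourhood of it and `W` is a local left inverse of `w e^w` there. -/
theorem hasStrictDerivAt_lambertW {k : LambertBranch} {x : ℝ}
    (hx : x ∈ interior (lambertDomain k)) :
    HasStrictDerivAt (lambertW k)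
      ((1 + lambertW k x) * Real.exp (lambertW k x))⁻¹ x := by
  have hne := one_add_lambertW_ne_zero hx
  have hmem := lambertW_mem (interior_subset hx)
  have hnhds : lambertRange k ∈ 𝓝 (lambertW k x) := by
    cases k
    · refine Ici_mem_nhds (lt_of_le_of_ne hmem fun h => hne ?_)
      rw [← h]; ring
    · refine Iic_mem_nhds (lt_of_le_of_ne hmem fun h => hne ?_)
      rw [h]; ring
  have h := (hasStrictDerivAt_mul_exp (lambertW k x)).to_local_left_inverse
    (mul_ne_zero hne (Real.exp_ne_zero _)) (g := lambertW k)
    (Filter.mem_of_superset hnhds fun w hw => lambertW_apply_mul_exp hw)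
  rwa [lambertW_mul_exp (interior_subset hx)] at h

/-! ### The resummed mass equation -/

/-- The Lambert equation `w e^w = Δ` in terms of the exponent `L = -w - a`. -/
theorem mul_exp_eq_Delta_iff (g M L : ℝ) :
    (-(L + expo g M)) * Real.exp (-(L + expo g M)) = Delta g M ↔
      L + expo g M = (M / (2 * g) + 1) * Real.exp L := by
  have h : Real.exp (-expo g M) = Real.exp (-(L + expo g M)) * Real.exp L := by
    rw [← Real.exp_add]; ring_nf
  rw [Delta, h]
  have hp := Real.exp_pos (-(L + expo g M))
  constructor
  · intro h
    have : Real.exp (-(L + expo g M)) * (L + expo g M) =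
      Real.exp (-(L + expo g M)) * ((M / (2 * g) + 1) * Real.exp L) := by linarith
    exact mul_left_cancel₀ hp.ne' this
  · intro h
    rw [h]; ring

/-- At `L = 0` the two sides differ by `1 / (2g)`. This keeps the inverse defining `u⋆` from being
the junk value `0⁻¹`. -/
theorem exp_exponent_ne_one {g M L : ℝ} (hg : g ≠ 0)
    (hL : L + expo g M = (M / (2 * g) + 1) * Real.exp L) : Real.exp L ≠ 1 := by
  intro h1
  have hL0 : L = 0 := by simpa using h1
  rw [h1, hL0, expo] at hL
  field_simp at hL
  linarith

theorem lambertW_exponent {k : LambertBranch} {g M : ℝ} (hD : Delta g M ∈ lambertDomain k) :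
    (-lambertW k (Delta g M) - expo g M) + expo g M =
      (M / (2 * g) + 1) * Real.exp (-lambertW k (Delta g M) - expo g M) := by
  rw [← mul_exp_eq_Delta_iff]
  have h := lambertW_mul_exp hD
  convert h using 2 <;> ring_nf

theorem exp_lambertW_exponent_sub_one_ne_zero {k : LambertBranch} {g M : ℝ} (hg : g ≠ 0)
    (hD : Delta g M ∈ lambertDomain k) :
    Real.exp (-lambertW k (Delta g M) - expo g M) - 1 ≠ 0 :=
  sub_ne_zero.2 (exp_exponent_ne_one hg (lambertW_exponent hD))

theorem uStar_ne_zero {k : LambertBranch} {g M : ℝ} (hg : g ≠ 0)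
    (hD : Delta g M ∈ lambertDomain k) : uStar k g M ≠ 0 :=
  inv_ne_zero (exp_lambertW_exponent_sub_one_ne_zero hg hD)

theorem inv_exp_sub_one_massEquation {g M L : ℝ} (hg : g ≠ 0)
    (hL : L + expo g M = (M / (2 * g) + 1) * Real.exp L) :
    (0 < (Real.exp L - 1)⁻¹ ∨ (Real.exp L - 1)⁻¹ < -1) ∧
      (Real.exp L - 1)⁻¹ = (M + 2 * g) - 2 * g * (Real.exp L - 1)⁻¹ *
        Real.log ((1 + (Real.exp L - 1)⁻¹) / (Real.exp L - 1)⁻¹) := by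
  have hne := sub_ne_zero.2 (exp_exponent_ne_one hg hL)
  have hp := Real.exp_pos L
  constructor
  · rcases lt_or_gt_of_ne hne with h | h
    · right
      rw [← one_div, div_lt_iff_of_neg h]
      linarith
    · left; exact inv_pos.2 h
  · have h1 : (1 + (Real.exp L - 1)⁻¹) / (Real.exp L - 1)⁻¹ = Real.exp L := by
      field_simp; ring
    rw [h1, Real.log_exp]
    rw [expo] at hL
    field_simp at hL ⊢
    linarith

theorem massEquation_exponent {g M u : ℝ} (hg : g ≠ 0) (hu : 0 < u ∨ u < -1)
    (h : u = (M + 2 * g) - 2 * g * u * Real.log ((1 + u) / u)) :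
    Real.log ((1 + u) / u) + expo g M =
      (M / (2 * g) + 1) * Real.exp (Real.log ((1 + u) / u)) ∧
    u = (Real.exp (Real.log ((1 + u) / u)) - 1)⁻¹ := by
  have hu0 : u ≠ 0 := by rcases hu with h | h <;> linarith
  have hpos : 0 < (1 + u) / u := by
    rcases hu with h | h
    · positivity
    · exact div_pos_of_neg_of_neg (by linarith) (by linarith)
  rw [Real.exp_log hpos]
  constructor
  · rw [expo]
    field_simp
    linarith
  · have : (1 + u) / u - 1 = u⁻¹ := by field_simp; ring
    rw [this, inv_inv]

theorem massEquation_iff {g M u : ℝ} (hg : g ≠ 0) :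
    ((0 < u ∨ u < -1) ∧ u = (M + 2 * g) - 2 * g * u * Real.log ((1 + u) / u)) ↔
      ∃ k : LambertBranch, Delta g M ∈ lambertDomain k ∧ u = uStar k g M := by
  constructor
  · rintro ⟨hu, h⟩
    obtain ⟨hL, huL⟩ := massEquation_exponent hg hu h
    set L := Real.log ((1 + u) / u)
    have hD := (mul_exp_eq_Delta_iff g M L).2 hL
    have key : ∀ k, -(L + expo g M) ∈ lambertRange k →
        Delta g M ∈ lambertDomain k ∧ u = uStar k g M := by
      intro k hk
      rw [← hD]
      refine ⟨mul_exp_mem_lambertDomain hk, ?_⟩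
      rw [uStar, ← hD, lambertW_apply_mul_exp hk, huL]
      ring_nf
    -- The two ranges cover the line, so any real solution lies on a branch.
    rcases le_total (-1) (-(L + expo g M)) with h1 | h1
    · exact ⟨.principal, key .principal h1⟩
    · exact ⟨.lower, key .lower h1⟩
  · rintro ⟨k, hD, rfl⟩
    exact inv_exp_sub_one_massEquation hg (lambertW_exponent hD)

theorem Delta_mem_interior_lower {g M : ℝ} (hg : 0 < g) (hM : 0 < M) :
    Delta g M ∈ interior (lambertDomain .lower) := by
  simp only [lambertDomain, interior_Ico, Set.mem_Ioo]
  have hx : 0 < M / (2 * g) + 1 := by positivity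
  -- With `c = M / (2g) + 1` one has `a = c + 1 / (2g) > c`, hence `Δ = -c e^{-a} > -c e^{-c} ≥
  -- -1/e`.
  have hlt : -(M / (2 * g) + 1) > -expo g M := by
    have : expo g M = M / (2 * g) + 1 + 1 / (2 * g) := by rw [expo]; field_simp; ring
    have h2 : 0 < 1 / (2 * g) := by positivity
    linarith
  constructor
  · refine (neg_exp_neg_one_le_mul_exp (-(M / (2 * g) + 1))).trans_lt ?_
    rw [Delta]
    have := Real.exp_lt_exp.2 hlt
    nlinarith
  · rw [Delta]
    exact mul_neg_of_neg_of_pos (by linarith) (Real.exp_pos _)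

theorem mem_interiorRegion_lower {g M : ℝ} (hg : 0 < g) (hM : 0 < M) :
    (g, M) ∈ interiorRegion .lower :=
  ⟨hg.ne', by simp only; positivity, Delta_mem_interior_lower hg hM⟩

theorem uStar_lower_pos {g M : ℝ} (hg : 0 < g) (hM : 0 < M) : 0 < uStar .lower g M := by
  have hD := interior_subset (Delta_mem_interior_lower hg hM)
  have hL := lambertW_exponent hD
  have hw : lambertW .lower (Delta g M) ≤ -1 := lambertW_mem hD
  rw [uStar, inv_pos]
  set L := -lambertW .lower (Delta g M) - expo g M with hLdef
  -- Suppose `L < 0` and put `c = M / (2g) + 1`. The Lambert equation gives `c (1 - e^L) < -L`, and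
  -- `W ≤ -1` gives `c e^L ≥ 1`. Together they yield `1 < e^L (1 - L)`, against the tangent bound.
  by_contra hcon
  have hL1 : Real.exp L ≤ 1 := by linarith
  have hL0 : L < 0 := by
    refine lt_of_le_of_ne (by simpa using hL1) fun h0 => exp_exponent_ne_one hg.ne' hL (by simp [h0])
  have hc : 1 ≤ M / (2 * g) + 1 := by linarith [show 0 < M / (2 * g) by positivity]
  have he : expo g M = M / (2 * g) + 1 + 1 / (2 * g) := by rw [expo]; field_simp; ring
  have hge : 1 ≤ L + expo g M := by linarith
  have h2 : 0 < 1 / (2 * g) := by positivity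
  have h3 : Real.exp L * (1 - L) ≤ 1 := by
    have := Real.add_one_le_exp (-L)
    have h4 : Real.exp L * Real.exp (-L) = 1 := by rw [← Real.exp_add]; simp
    nlinarith [Real.exp_pos L]
  nlinarith [Real.exp_pos L]

/-! ### Derivatives of the effective mass -/

theorem differentiableAt_expo {x : ℝ × ℝ} (hx : x.1 ≠ 0) :
    DifferentiableAt ℝ (fun y : ℝ × ℝ => expo y.1 y.2) x := by
  have : 2 * x.1 ≠ 0 := by simpa using hx
  unfold expo
  fun_prop (disch := assumption)

theorem differentiableAt_Delta {x : ℝ × ℝ} (hx : x.1 ≠ 0) :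
    DifferentiableAt ℝ (fun y : ℝ × ℝ => Delta y.1 y.2) x := by
  have : 2 * x.1 ≠ 0 := by simpa using hx
  have := differentiableAt_expo hx
  unfold Delta
  fun_prop (disch := assumption)

theorem differentiableAt_uStar {k : LambertBranch} {x : ℝ × ℝ} (hx : x ∈ interiorRegion k) :
    DifferentiableAt ℝ (fun y : ℝ × ℝ => uStar k y.1 y.2) x := by
  obtain ⟨hg, -, hD⟩ := hx
  have h1 := differentiableAt_expo hg
  have h2 := differentiableAt_Delta hg
  have h3 : DifferentiableAt ℝ (fun y : ℝ × ℝ => lambertW k (Delta y.1 y.2)) x :=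
    (hasStrictDerivAt_lambertW hD).hasDerivAt.differentiableAt.comp x h2
  exact ((((h3.neg).sub h1).exp).sub_const 1).inv
    (exp_lambertW_exponent_sub_one_ne_zero hg (interior_subset hD))

theorem differentiableAt_uStar_coupling {k : LambertBranch} {g M : ℝ}
    (hx : (g, M) ∈ interiorRegion k) : DifferentiableAt ℝ (fun g' => uStar k g' M) g :=
  DifferentiableAt.comp (f := fun g' : ℝ => (g', M)) g (differentiableAt_uStar hx) (by fun_prop)

theorem hasDerivAt_uStar_mass {k : LambertBranch} {g M : ℝ} (hx : (g, M) ∈ interiorRegion k) :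
    HasDerivAt (fun M' => uStar k g M')
      (-uStar k g M / (2 * (g * Real.exp (lambertW k (Delta g M) + expo g M) *
        (1 + lambertW k (Delta g M))))) M := by
  obtain ⟨hg, -, hD⟩ := hx
  simp only at hg hD
  have hne := exp_lambertW_exponent_sub_one_ne_zero hg (interior_subset hD)
  have hL := lambertW_exponent (interior_subset hD)
  have hW := one_add_lambertW_ne_zero hD
  have ha : HasDerivAt (fun M' => expo g M') (1 / (2 * g)) M :=
    (((hasDerivAt_id M).const_add 1).add_const (2 * g)).div_const (2 * g)
  have hΔ : HasDerivAt (fun M' => Delta g M')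
      (-(1 / (2 * g)) * Real.exp (-expo g M) +
        -(M / (2 * g) + 1) * (Real.exp (-expo g M) * -(1 / (2 * g)))) M :=
    ((((hasDerivAt_id M).div_const (2 * g)).add_const 1).neg).mul ha.neg.exp
  have hWd := (hasStrictDerivAt_lambertW hD).hasDerivAt.comp M hΔ
  have h := (((hWd.neg).sub ha).exp.sub_const 1).inv hne
  refine h.congr_deriv ?_
  simp only [Pi.neg_apply, Pi.sub_apply, Function.comp_apply, uStar]
  set w := lambertW k (Delta g M)
  set L := -w - expo g M with hLdef
  have h1 : Real.exp (-expo g M) = Real.exp L * Real.exp w := by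
    rw [← Real.exp_add]; congr 1; linarith
  have h2 : Real.exp (w + expo g M) = (Real.exp L)⁻¹ := by
    rw [← Real.exp_neg]; congr 1; linarith
  have hE := (Real.exp_pos L).ne'
  have hE' := (Real.exp_pos w).ne'
  have h3 : w = -((M / (2 * g) + 1) * Real.exp L) := by linarith
  rw [h1, h2]
  set E := Real.exp L
  set E' := Real.exp w
  -- The Lambert equation eliminates `M + 2g`, which collapses the chain rule expression to the
  -- stated quotient.
  have h4 : 2 * g * w = -((M + 2 * g) * E) := by rw [h3]; field_simp
  field_simp
  linear_combination h4

theorem uStar_mass_derivative_ne_zero {k : LambertBranch} {g M : ℝ}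
    (hx : (g, M) ∈ interiorRegion k) :
    g * Real.exp (lambertW k (Delta g M) + expo g M) * (1 + lambertW k (Delta g M)) ≠ 0 :=
  mul_ne_zero (mul_ne_zero hx.1 (Real.exp_ne_zero _)) (one_add_lambertW_ne_zero hx.2.2)

/-! ### The Callan-Symanzik equations -/

theorem hasDerivAt_rpow_cutoff (p : ℝ) {Λ : ℝ} (hΛ : 0 < Λ) :
    HasDerivAt (fun x : ℝ => x ^ p) (p * Λ ^ p / Λ) Λ := by
  have h := Real.hasDerivAt_rpow_const (x := Λ) (p := p) (Or.inl hΛ.ne')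
  rwa [Real.rpow_sub_one hΛ.ne', ← mul_div_assoc] at h

theorem hasDerivAt_dimensionless_mass {f : ℝ → ℝ} {f' p Λ M : ℝ} (hΛ : 0 < Λ)
    (hf : HasDerivAt f f' M) :
    HasDerivAt (fun x : ℝ => f (M * Λ ^ p / x ^ p)) (-(f' * (M * p)) / Λ) Λ := by
  have hN := Real.rpow_pos_of_pos hΛ p
  have hfM : HasDerivAt f f' (M * Λ ^ p / Λ ^ p) := by
    rwa [mul_div_cancel_right₀ _ hN.ne']
  have h := hfM.comp Λ
    (((hasDerivAt_const Λ (M * Λ ^ p)).div (hasDerivAt_rpow_cutoff p hΛ) hN.ne'))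
  refine h.congr_deriv ?_
  field_simp
  ring

/-- The canonical term `2η m^{2η}` of the mass flow cancels the `Λ`-derivative acting through
`m^{2η} / Λ^{2η}`. -/
theorem csDerivative_dimensionless {d : ℕ} {β b Λ g M fg fM : ℝ} {f : ℝ → ℝ → ℝ} (hΛ : 0 < Λ)
    (hg : HasDerivAt (fun g' => f g' M) fg g) (hM : HasDerivAt (f g) fM M) :
    csDerivative d β b (fun Λ g μ => f g (μ / Λ ^ (2 * eta d))) Λ g (M * Λ ^ (2 * eta d)) =
      β * fg + b * fM := by
  set p := 2 * eta d
  have hN := Real.rpow_pos_of_pos hΛ p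
  have hμ : M * Λ ^ p / Λ ^ p = M := mul_div_cancel_right₀ _ hN.ne'
  have h3 : HasDerivAt (fun μ' => f g (μ' / Λ ^ p)) (fM * (1 / Λ ^ p)) (M * Λ ^ p) := by
    refine HasDerivAt.comp (M * Λ ^ p) (h₂ := f g) (by rwa [hμ]) ((hasDerivAt_id _).div_const _)
  rw [csDerivative, (hasDerivAt_dimensionless_mass hΛ hM).deriv, h3.deriv, hμ, hg.deriv]
  field_simp
  ring

/-- The same cancellation occurs; the prefactor `Λ^{2η}` contributes the extra canonical term `2η
f`, which later obstructs fixed points. -/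
theorem csDerivative_dimensionful {d : ℕ} {β b Λ g M fg fM : ℝ} {f : ℝ → ℝ → ℝ} (hΛ : 0 < Λ)
    (hg : HasDerivAt (fun g' => f g' M) fg g) (hM : HasDerivAt (f g) fM M) :
    csDerivative d β b (fun Λ g μ => Λ ^ (2 * eta d) * f g (μ / Λ ^ (2 * eta d))) Λ g
      (M * Λ ^ (2 * eta d)) =
      Λ ^ (2 * eta d) * (2 * eta d * f g M + β * fg + b * fM) := by
  rw [csDerivative]
  set p := 2 * eta d
  have hN := Real.rpow_pos_of_pos hΛ p
  have hμ : M * Λ ^ p / Λ ^ p = M := mul_div_cancel_right₀ _ hN.ne'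
  have h1 := (hasDerivAt_rpow_cutoff p hΛ).mul (hasDerivAt_dimensionless_mass (p := p) hΛ hM)
  have h2 : HasDerivAt (fun g' => Λ ^ p * f g' (M * Λ ^ p / Λ ^ p)) (Λ ^ p * fg) g := by
    rw [hμ]; exact hg.const_mul _
  have h3 : HasDerivAt (fun μ' => Λ ^ p * f g (μ' / Λ ^ p)) (Λ ^ p * (fM * (1 / Λ ^ p)))
      (M * Λ ^ p) := by
    refine HasDerivAt.const_mul _ ?_
    refine HasDerivAt.comp (M * Λ ^ p) (h₂ := f g) (by rwa [hμ]) ((hasDerivAt_id _).div_const _)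
  have h1' := h1.deriv
  rw [hμ] at h1'
  rw [show (fun Λ' => Λ' ^ p * f g (M * Λ ^ p / Λ' ^ p)) =
    (fun x => x ^ p) * fun x => f g (M * Λ ^ p / x ^ p) from rfl, h1', h2.deriv, h3.deriv]
  field_simp
  ring

theorem iota_pos {d : ℕ} (hd : 2 ≤ d) : 0 < iota d := by
  have hd' : (2 : ℝ) ≤ d := by exact_mod_cast hd
  have : 0 < ((d : ℝ) + 1) / (d - 1) := div_pos (by linarith) (by linarith)
  exact mul_pos (by positivity) (pow_pos (Real.Gamma_pos_of_pos this) _)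

theorem isFlow_iff {k : LambertBranch} {d : ℕ} {g M β b γ ug : ℝ} (hd : 2 ≤ d)
    (hx : (g, M) ∈ interiorRegion k) (hX : 1 - 2 * g / (d * (1 + M)) ≠ 0)
    (hug : HasDerivAt (fun g' => uStar k g' M) ug g) :
    IsFlow k d g M β b γ ↔
      (2 * eta d * uStar k g M + β * ug +
        b * (-uStar k g M / (2 * (g * Real.exp (lambertW k (Delta g M) + expo g M) *
          (1 + lambertW k (Delta g M))))) = γ * uStar k g M ∧
      β - b * (2 * g ^ 2 / (d * (1 + M) ^ 2)) = γ * g * (1 - 2 * g / (d * (1 + M)))) := by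
  have hι := (iota_pos hd).ne'
  have hd0 : (d : ℝ) ≠ 0 := by positivity
  have hM : 1 + M ≠ 0 := hx.2.1
  set f : ℝ → ℝ → ℝ := fun g M =>
    4 * bareCoupling d g / (1 - 2 * bareCoupling d g * iota d / (1 + M)) with hf
  have hden : 1 - 2 * bareCoupling d g * iota d / (1 + M) = 1 - 2 * g / (d * (1 + M)) := by
    rw [bareCoupling]; field_simp
  have hden0 : 1 - 2 * bareCoupling d g * iota d / (1 + M) ≠ 0 := by rwa [hden]
  set X := 1 - 2 * g / (d * (1 + M)) with hXdef
  have hXmul : X * (d * (1 + M)) = d * (1 + M) - 2 * g := by rw [hXdef]; field_simp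
  have hfv : f g M = 4 / (d * iota d) * (g / X) := by
    simp only [hf]; rw [hden, bareCoupling]; field_simp
  have hbg : HasDerivAt (bareCoupling d) (1 / (d * iota d)) g :=
    (hasDerivAt_id g).div_const _
  have hfg : HasDerivAt (fun g' => f g' M) (4 / (d * iota d) * (1 / X ^ 2)) g := by
    have h := (hbg.const_mul 4).div
      (((((hbg.const_mul 2).mul_const (iota d)).div_const (1 + M)).const_sub 1)) hden0
    refine h.congr_deriv ?_
    rw [hden, bareCoupling]
    field_simp
    linear_combination hXmul
  have hfM : HasDerivAt (f g)
      (-(4 / (d * iota d) * (2 * g ^ 2 / (d * (1 + M) ^ 2) / X ^ 2))) M := by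
    have h := (hasDerivAt_const M (4 * bareCoupling d g)).div
      (((hasDerivAt_const M (2 * bareCoupling d g * iota d)).div
        ((hasDerivAt_id M).const_add 1) hM).const_sub 1) hden0
    refine h.congr_deriv ?_
    simp only [id, Pi.div_apply]
    rw [hden, bareCoupling]
    field_simp
    ring
  have h1 := fun Λ (hΛ : 0 < Λ) => csDerivative_dimensionful (d := d) (β := β) (b := b)
    (f := uStar k) hΛ hug (hasDerivAt_uStar_mass hx)
  have h2 := fun Λ (hΛ : 0 < Λ) => csDerivative_dimensionless (d := d) (β := β) (b := b)
    (f := f) hΛ hfg hfM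
  have hpt : ∀ Λ : ℝ, 0 < Λ →
      ((csDerivative d β b (gammaTwo k d) Λ g (M * Λ ^ (2 * eta d)) =
          γ * gammaTwo k d Λ g (M * Λ ^ (2 * eta d)) ∧
        csDerivative d β b (wardRatio d) Λ g (M * Λ ^ (2 * eta d)) =
          γ * wardRatio d Λ g (M * Λ ^ (2 * eta d))) ↔
      (2 * eta d * uStar k g M + β * ug +
        b * (-uStar k g M / (2 * (g * Real.exp (lambertW k (Delta g M) + expo g M) *
          (1 + lambertW k (Delta g M))))) = γ * uStar k g M ∧
      β - b * (2 * g ^ 2 / (d * (1 + M) ^ 2)) = γ * g * X)) := by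
    intro Λ hΛ
    have hN := Real.rpow_pos_of_pos hΛ (2 * eta d)
    have hμ : M * Λ ^ (2 * eta d) / Λ ^ (2 * eta d) = M := mul_div_cancel_right₀ _ hN.ne'
    have hv1 : gammaTwo k d Λ g (M * Λ ^ (2 * eta d)) = Λ ^ (2 * eta d) * uStar k g M := by
      rw [gammaTwo, hμ]
    have hv2 : wardRatio d Λ g (M * Λ ^ (2 * eta d)) = f g M := by
      rw [wardRatio, hμ]
    rw [hv1, hv2, hfv]
    rw [show csDerivative d β b (gammaTwo k d) Λ g (M * Λ ^ (2 * eta d)) = _ from h1 Λ hΛ,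
      show csDerivative d β b (wardRatio d) Λ g (M * Λ ^ (2 * eta d)) = _ from h2 Λ hΛ]
    refine and_congr ?_ ?_
    · rw [show γ * (Λ ^ (2 * eta d) * uStar k g M) = Λ ^ (2 * eta d) * (γ * uStar k g M) by ring]
      exact mul_right_inj' hN.ne'
    -- Every term of the Ward equation carries this common factor, which is cancelled.
    · have hc : 4 / (d * iota d) * (1 / X ^ 2) ≠ 0 := by positivity
      refine Iff.trans ?_ (mul_right_inj' hc)
      refine Eq.congr ?_ ?_
      · ring
      · field_simp
  constructor
  · intro h
    exact (hpt 1 one_pos).1 (h 1 one_pos)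
  · intro h Λ hΛ
    exact (hpt Λ hΛ).2 h

/-! ### The large rank limit of the flow -/

theorem four_mul_eta (d : ℕ) : 4 * eta d = d - 1 := by rw [eta]; ring

theorem tendsto_inv_four_mul_eta : Tendsto (fun d : ℕ => (4 * eta d)⁻¹) atTop (𝓝 0) := by
  simp only [four_mul_eta]
  exact (tendsto_atTop_add_const_right atTop (-1 : ℝ) tendsto_natCast_atTop_atTop).inv_tendsto_atTop

theorem tendsto_const_div_rank_mul (c e : ℝ) :
    Tendsto (fun d : ℕ => c / (d * e)) atTop (𝓝 0) := by
  have h := (tendsto_natCast_atTop_atTop (R := ℝ)).inv_tendsto_atTop.const_mul (c / e)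
  rw [mul_zero] at h
  refine h.congr fun d => ?_
  simp only [Pi.inv_apply]
  rw [div_mul_eq_div_div_swap, div_eq_mul_inv (c / e)]

theorem tendsto_const_div_rank_mul_eta (c e : ℝ) :
    Tendsto (fun d : ℕ => c / (d * e) * (4 * eta d)) atTop (𝓝 (c / e)) := by
  have h := (tendsto_const_div_rank_mul c e).const_sub (c / e)
  rw [sub_zero] at h
  refine h.congr' ?_
  filter_upwards [eventually_gt_atTop 0] with d hd
  have : (d : ℝ) ≠ 0 := by positivity
  rw [four_mul_eta]
  rcases eq_or_ne e 0 with rfl | he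
  · simp
  · field_simp

theorem eventually_eta_pos : ∀ᶠ d : ℕ in atTop, 0 < 4 * eta d := by
  filter_upwards [eventually_gt_atTop 1] with d hd
  have : (1 : ℝ) < d := by exact_mod_cast hd
  rw [four_mul_eta]
  linarith

theorem tendsto_ward_denominator (g M : ℝ) :
    Tendsto (fun d : ℕ => 1 - 2 * g / (d * (1 + M))) atTop (𝓝 1) := by
  simpa using (tendsto_const_div_rank_mul (2 * g) (1 + M)).const_sub 1

/-- The coupling derivative of `u⋆` stays an unspecified constant `ug`: its coefficient vanishes in
both large rank limits, so no formula for it is needed. -/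
theorem eventually_isFlow_iff {k : LambertBranch} {g M : ℝ} (hx : (g, M) ∈ interiorRegion k) :
    ∃ ug : ℝ, ∀ᶠ d : ℕ in atTop, ∀ β b γ : ℝ, IsFlow k d g M β b γ ↔
      (2 * eta d * uStar k g M + β * ug +
        b * (-uStar k g M / (2 * (g * Real.exp (lambertW k (Delta g M) + expo g M) *
          (1 + lambertW k (Delta g M))))) = γ * uStar k g M ∧
      β - b * (2 * g ^ 2 / (d * (1 + M) ^ 2)) = γ * g * (1 - 2 * g / (d * (1 + M)))) := by
  refine ⟨deriv (fun g' => uStar k g' M) g, ?_⟩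
  filter_upwards [eventually_ge_atTop 2,
    (tendsto_ward_denominator g M).eventually_ne one_ne_zero] with d hd hX β b γ
  exact isFlow_iff hd hx hX (differentiableAt_uStar_coupling hx).hasDerivAt

theorem isLargeRankBeta_zero_iff {k : LambertBranch} {g M : ℝ} (hx : (g, M) ∈ interiorRegion k)
    (B b : ℝ) :
    IsLargeRankBeta k (fun _ => 0) g M B b ↔
      b = g * Real.exp (lambertW k (Delta g M) + expo g M) * (1 + lambertW k (Delta g M)) ∧
      B = 2 * g ^ 3 / (1 + M) ^ 2 * Real.exp (lambertW k (Delta g M) + expo g M) *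
        (1 + lambertW k (Delta g M)) := by
  obtain ⟨ug, hug⟩ := eventually_isFlow_iff hx
  have hu := uStar_ne_zero hx.1 (interior_subset hx.2.2)
  simp only at hu
  have hK := uStar_mass_derivative_ne_zero hx
  set u := uStar k g M
  have hB : 2 * g ^ 3 / (1 + M) ^ 2 * Real.exp (lambertW k (Delta g M) + expo g M) *
      (1 + lambertW k (Delta g M)) = 2 * g ^ 2 / (1 + M) ^ 2 *
      (g * Real.exp (lambertW k (Delta g M) + expo g M) * (1 + lambertW k (Delta g M))) := by ring
  rw [hB]
  set K := g * Real.exp (lambertW k (Delta g M) + expo g M) * (1 + lambertW k (Delta g M))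
  set c : ℕ → ℝ := fun d => 2 * g ^ 2 / (d * (1 + M) ^ 2) with hc
  -- At `γ = 0` the Ward equation reads `β = c_d b`. Substituting leaves `b D_d = -2η u`, so `b /
  -- (4η) = -(u / 2) / D_d`, which tends to `K`; in `β` the decay of `c_d` is compensated by the
  -- factor `4η`.
  set D : ℕ → ℝ := fun d => c d * ug + -u / (2 * K) with hD
  have hDlim : Tendsto D atTop (𝓝 (-u / (2 * K))) := by
    simpa using ((tendsto_const_div_rank_mul (2 * g ^ 2) ((1 + M) ^ 2)).mul_const ug).add_const
      (-u / (2 * K))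
  have hD0 : -u / (2 * K) ≠ 0 := div_ne_zero (neg_ne_zero.2 hu) (mul_ne_zero two_ne_zero hK)
  have hblim : Tendsto (fun d => -u / 2 / D d) atTop (𝓝 K) := by
    have h := (tendsto_const_nhds (x := -u / 2)).div hDlim hD0
    rwa [show -u / 2 / (-u / (2 * K)) = K by field_simp] at h
  have hBlim : Tendsto (fun d : ℕ => c d * (4 * eta d) * (-u / 2 / D d)) atTop
      (𝓝 (2 * g ^ 2 / (1 + M) ^ 2 * K)) :=
    (tendsto_const_div_rank_mul_eta _ _).mul hblim
  constructor
  · rintro ⟨β, β', hflow, hβ, hβ'⟩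
    have hev : ∀ᶠ d : ℕ in atTop, -u / 2 / D d = β' d / (4 * eta d) ∧
        c d * (4 * eta d) * (-u / 2 / D d) = β d := by
      filter_upwards [hflow, hug, hDlim.eventually_ne hD0, eventually_eta_pos]
        with d h1 h2 h3 h4
      obtain ⟨e1, e2⟩ := (h2 _ _ _).1 h1
      have e3 : β d = β' d * c d := by
        simp only [hc]; linarith
      have e4 : -u / 2 / D d = β' d / (4 * eta d) := by
        rw [div_eq_div_iff h3 h4.ne']
        rw [e3] at e1
        simp only [hD]
        linear_combination -e1
      refine ⟨e4, ?_⟩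
      rw [e4, e3, mul_assoc, mul_div_cancel₀ _ h4.ne', mul_comm]
    exact ⟨(tendsto_nhds_unique (hblim.congr' (hev.mono fun _ h => h.1)) hβ').symm,
      (tendsto_nhds_unique (hBlim.congr' (hev.mono fun _ h => h.2)) hβ).symm⟩
  · rintro ⟨rfl, rfl⟩
    refine ⟨fun d => c d * (4 * eta d) * (-u / 2 / D d), fun d => 4 * eta d * (-u / 2 / D d),
      ?_, hBlim, hblim.congr' ?_⟩
    · filter_upwards [hug, hDlim.eventually_ne hD0] with d h2 h3
      rw [h2]
      refine ⟨?_, ?_⟩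
      · have h4 : -u / 2 / D d * D d = -u / 2 := div_mul_cancel₀ _ h3
        have h5 : -u / 2 / D d * (c d * ug + -u / (2 * K)) = -u / 2 := h4
        linear_combination (4 * eta d) * h5
      · simp only [hc]; ring
    · filter_upwards [eventually_eta_pos] with d h4
      rw [mul_div_cancel_left₀ _ h4.ne']

theorem largeRankFixedPoints_eq_empty (k : LambertBranch) : largeRankFixedPoints k = ∅ := by
  rw [Set.eq_empty_iff_forall_notMem]
  rintro ⟨g, M⟩ ⟨hx, γ, β, b, hflow, hβ, hb⟩
  simp only at hflow
  obtain ⟨ug, hug⟩ := eventually_isFlow_iff hx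
  have hu := uStar_ne_zero hx.1 (interior_subset hx.2.2)
  have hg : g ≠ 0 := hx.1
  simp only at hu
  set u := uStar k g M
  set K := g * Real.exp (lambertW k (Delta g M) + expo g M) * (1 + lambertW k (Delta g M))
  have hX := tendsto_ward_denominator g M
  -- In the Ward equation `b_d` is multiplied by a term of order `1 / d`, so `b_d / (4η) → 0`
  -- already makes that product vanish; together with `β_d → 0` this fixes the limit of `γ_d`.
  have hγ : Tendsto γ atTop (𝓝 0) := by
    have h := ((hβ.sub ((tendsto_const_div_rank_mul_eta (2 * g ^ 2) ((1 + M) ^ 2)).mul hb)).div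
      hX one_ne_zero).div_const g
    simp only [mul_zero, sub_zero, zero_div] at h
    refine h.congr' ?_
    filter_upwards [hflow, hug, hX.eventually_ne one_ne_zero, eventually_eta_pos]
      with d h1 h2 h3 h4
    have e2 := ((h2 _ _ _).1 h1).2
    have e3 : 2 * g ^ 2 / (d * (1 + M) ^ 2) * (4 * eta d) * (b d / (4 * eta d)) =
        b d * (2 * g ^ 2 / (d * (1 + M) ^ 2)) := by
      rw [mul_assoc, mul_div_cancel₀ _ h4.ne', mul_comm]
    simp only [Pi.div_apply]
    rw [e3, e2, mul_div_cancel_right₀ _ h3, mul_div_cancel_right₀ _ hg]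
  have hη := tendsto_inv_four_mul_eta
  have hlim : Tendsto (fun d : ℕ => γ d * (4 * eta d)⁻¹ * u - β d * (4 * eta d)⁻¹ * ug -
      b d / (4 * eta d) * (-u / (2 * K))) atTop (𝓝 0) := by
    have h := (((hγ.mul hη).mul_const u).sub ((hβ.mul hη).mul_const ug)).sub
      (hb.mul_const (-u / (2 * K)))
    simpa using h
  -- Dividing the two-point equation by `4η` identifies the vanishing sequence with the constant
  -- canonical term.
  have hlim' : Tendsto (fun _ : ℕ => u / 2) atTop (𝓝 0) := by
    refine hlim.congr' ?_
    filter_upwards [hflow, hug, eventually_eta_pos] with d h1 h2 h4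
    have e1 := ((h2 _ _ _).1 h1).1
    have e5 : eta d * (4 * eta d)⁻¹ = 1 / 4 := by
      have : eta d ≠ 0 := fun h => by rw [h] at h4; simp at h4
      field_simp
    linear_combination (-(4 * eta d)⁻¹) * e1 + 2 * u * e5
  have := tendsto_nhds_unique hlim' tendsto_const_nhds
  exact hu (by linarith)

/-! ### The closed Schwinger-Dyson equation -/

/-- The right hand side of the closed Schwinger-Dyson equation for `σ = -τ`, with momenta
restricted to `Q` and bare two-point function `w`. -/
noncomputable def sdMap {d : ℕ} (Q : Finset (Fin d → ℤ)) (w : (Fin d → ℤ) → ℝ) (c : ℝ) (i : Fin d)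
    (σ : ℤ → ℝ) (p : ℤ) : ℝ :=
  c * ∑ q ∈ Q with q i = p, (w q + ∑ j, σ (q j))⁻¹

section sdMap

variable {d : ℕ} {Q : Finset (Fin d → ℤ)} {w : (Fin d → ℤ) → ℝ} {c : ℝ} {i : Fin d}

theorem sdMap_denominator_pos (hw : ∀ q, 0 < w q) {σ : ℤ → ℝ} (hσ : ∀ p, 0 ≤ σ p)
    (q : Fin d → ℤ) : 0 < w q + ∑ j, σ (q j) :=
  add_pos_of_pos_of_nonneg (hw q) (Finset.sum_nonneg fun j _ => hσ (q j))

theorem sdMap_pos (hc : 0 < c) (hw : ∀ q, 0 < w q) {σ : ℤ → ℝ} (hσ : ∀ p, 0 ≤ σ p) {p : ℤ}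
    (hp : ∃ q ∈ Q, q i = p) : 0 < sdMap Q w c i σ p := by
  obtain ⟨q, hq, hqp⟩ := hp
  exact mul_pos hc (Finset.sum_pos (fun q _ => inv_pos.2 (sdMap_denominator_pos hw hσ q))
    ⟨q, Finset.mem_filter.2 ⟨hq, hqp⟩⟩)

theorem sdMap_eq_zero {σ : ℤ → ℝ} {p : ℤ} (hp : ¬ ∃ q ∈ Q, q i = p) :
    sdMap Q w c i σ p = 0 := by
  push Not at hp
  rw [sdMap, Finset.filter_false_of_mem hp, Finset.sum_empty, mul_zero]

/-- The bare term is not scaled: `w + ∑ x ≤ w + t ∑ y < t (w + ∑ y)`, since `w > 0` and `t > 1`. -/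
theorem sdMap_lt_mul (hc : 0 < c) (hw : ∀ q, 0 < w q) {x y : ℤ → ℝ} (hx : ∀ p, 0 ≤ x p)
    (hy : ∀ p, 0 ≤ y p) {t : ℝ} (ht : 1 < t) (hxy : ∀ p, x p ≤ t * y p) {p : ℤ}
    (hp : ∃ q ∈ Q, q i = p) : sdMap Q w c i y p < t * sdMap Q w c i x p := by
  obtain ⟨q, hq, hqp⟩ := hp
  have key : ∀ q, (w q + ∑ j, y (q j))⁻¹ < t * (w q + ∑ j, x (q j))⁻¹ := by
    intro q
    have h1 := sdMap_denominator_pos hw hx q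
    have h2 := sdMap_denominator_pos hw hy q
    have h3 : ∑ j, x (q j) ≤ t * ∑ j, y (q j) := by
      rw [Finset.mul_sum]
      exact Finset.sum_le_sum fun j _ => hxy (q j)
    rw [← div_eq_mul_inv, inv_eq_one_div, div_lt_div_iff₀ h2 h1]
    nlinarith [hw q]
  rw [sdMap, sdMap, mul_left_comm, Finset.mul_sum _ _ t]
  have hne : (Q.filter fun q => q i = p).Nonempty := ⟨q, Finset.mem_filter.2 ⟨hq, hqp⟩⟩
  exact mul_lt_mul_of_pos_left (Finset.sum_lt_sum_of_nonempty hne fun q _ => key q) hc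

/-- Fixed points and two-cycles of `sdMap` coincide. -/
theorem sdMap_fixed_unique (hc : 0 < c) (hw : ∀ q, 0 < w q) {x y x' y' : ℤ → ℝ}
    (hx : ∀ p, 0 ≤ x p) (hy : ∀ p, 0 ≤ y p) (h : x' = x ∧ y' = y ∨ x' = y ∧ y' = x)
    (hxx : ∀ p, x p = sdMap Q w c i x' p) (hyy : ∀ p, y p = sdMap Q w c i y' p) : x = y := by
  have hx' : ∀ p, 0 ≤ x' p := by rcases h with ⟨rfl, rfl⟩ | ⟨rfl, rfl⟩ <;> assumption
  have hy' : ∀ p, 0 ≤ y' p := by rcases h with ⟨rfl, rfl⟩ | ⟨rfl, rfl⟩ <;> assumption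
  have hxpos : ∀ p, (∃ q ∈ Q, q i = p) → 0 < x p := fun p hp => by
    rw [hxx]; exact sdMap_pos hc hw hx' hp
  have hypos : ∀ p, (∃ q ∈ Q, q i = p) → 0 < y p := fun p hp => by
    rw [hyy]; exact sdMap_pos hc hw hy' hp
  have hzero : ∀ p, (¬ ∃ q ∈ Q, q i = p) → x p = 0 ∧ y p = 0 := fun p hp => by
    rw [hxx, hyy]; exact ⟨sdMap_eq_zero hp, sdMap_eq_zero hp⟩
  have hmem : ∀ p, (∃ q ∈ Q, q i = p) ↔ p ∈ Q.image (fun q => q i) := fun p => by simp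
  rcases (Q.image (fun q => q i)).eq_empty_or_nonempty with he | hne
  · funext p
    obtain ⟨h1, h2⟩ := hzero p (by rw [hmem, he]; simp)
    rw [h1, h2]
  obtain ⟨p₀, hp₀, hmax⟩ := Finset.exists_max_image (Q.image (fun q => q i))
    (fun p => max (x p / y p) (y p / x p)) hne
  -- `log t` is the Thompson distance of the two solutions, attained at `p₀`; if `t > 1`, strict
  -- contraction at `p₀` yields `t < t`.
  set t := max (x p₀ / y p₀) (y p₀ / x p₀) with ht
  have ht1 : 1 ≤ t := by
    have h1 := hxpos p₀ ((hmem _).2 hp₀)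
    have h2 := hypos p₀ ((hmem _).2 hp₀)
    rcases le_total (x p₀) (y p₀) with hle | hle
    · exact le_max_of_le_right ((one_le_div h1).2 hle)
    · exact le_max_of_le_left ((one_le_div h2).2 hle)
  have hcmp : ∀ p, x p ≤ t * y p ∧ y p ≤ t * x p := by
    intro p
    by_cases hp : ∃ q ∈ Q, q i = p
    · have hm := hmax p ((hmem p).1 hp)
      simp only [sup_le_iff] at hm
      exact ⟨(div_le_iff₀ (hypos p hp)).1 hm.1, (div_le_iff₀ (hxpos p hp)).1 hm.2⟩
    · obtain ⟨h1, h2⟩ := hzero p hp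
      rw [h1, h2]; simp
  have hcmp' : ∀ p, x' p ≤ t * y' p ∧ y' p ≤ t * x' p := by
    rcases h with ⟨rfl, rfl⟩ | ⟨rfl, rfl⟩
    · exact hcmp
    · exact fun p => (hcmp p).symm
  rcases ht1.eq_or_lt with h1 | h1
  · funext p
    have := hcmp p
    rw [← h1, one_mul, one_mul] at this
    exact le_antisymm this.1 this.2
  · exfalso
    have hp := (hmem _).2 hp₀
    have e1 := sdMap_lt_mul (Q := Q) (i := i) hc hw hx' hy' h1 (fun p => (hcmp' p).1) hp
    have e2 := sdMap_lt_mul (Q := Q) (i := i) hc hw hy' hx' h1 (fun p => (hcmp' p).2) hp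
    rw [← hxx, ← hyy] at e1 e2
    have e3 : t < t := by
      conv_lhs => rw [ht]
      exact max_lt ((div_lt_iff₀ (hypos _ hp)).2 e2) ((div_lt_iff₀ (hxpos _ hp)).2 e1)
    exact lt_irrefl _ e3

/-- `sdMap` on extended nonnegative reals. -/
noncomputable def sdMapENN (Q : Finset (Fin d → ℤ)) (w : (Fin d → ℤ) → ℝ) (c : ℝ) (i : Fin d)
    (σ : ℤ → ENNReal) (p : ℤ) : ENNReal :=
  ENNReal.ofReal c * ∑ q ∈ Q with q i = p, (ENNReal.ofReal (w q) + ∑ j, σ (q j))⁻¹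

theorem sdMapENN_antitone : Antitone (sdMapENN Q w c i) := fun x y hxy p => by
  unfold sdMapENN
  gcongr with q _ j
  exact hxy (q j)

theorem sdMapENN_ne_top (hw : ∀ q, 0 < w q) (σ : ℤ → ENNReal) (p : ℤ) :
    sdMapENN Q w c i σ p ≠ ⊤ := by
  refine ENNReal.mul_ne_top ENNReal.ofReal_ne_top (ENNReal.sum_ne_top.2 fun q _ => ?_)
  rw [ENNReal.inv_ne_top]
  exact (lt_of_lt_of_le (ENNReal.ofReal_pos.2 (hw q)) le_self_add).ne'

theorem toReal_sdMapENN (hc : 0 < c) (hw : ∀ q, 0 < w q) {σ : ℤ → ENNReal} (hσ : ∀ p, σ p ≠ ⊤)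
    (p : ℤ) : (sdMapENN Q w c i σ p).toReal = sdMap Q w c i (fun p => (σ p).toReal) p := by
  rw [sdMapENN, sdMap, ENNReal.toReal_mul, ENNReal.toReal_ofReal hc.le, ENNReal.toReal_sum]
  · congr 1
    refine Finset.sum_congr rfl fun q _ => ?_
    rw [ENNReal.toReal_inv, ENNReal.toReal_add ENNReal.ofReal_ne_top
      (ENNReal.sum_ne_top.2 fun j _ => hσ _), ENNReal.toReal_ofReal (hw q).le,
      ENNReal.toReal_sum fun j _ => hσ _]
  · intro q _
    rw [ENNReal.inv_ne_top]
    exact (lt_of_lt_of_le (ENNReal.ofReal_pos.2 (hw q)) le_self_add).ne'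

/-- Extended nonnegative functions form a complete lattice, so Knaster-Tarski applies to the
monotone square of the map. The resulting two-cycle is finite because the bare term bounds each
inverse, and it collapses to a fixed point. -/
theorem exists_sdMap_fixed (hc : 0 < c) (hw : ∀ q, 0 < w q) :
    ∃ σ : ℤ → ℝ, (∀ p, 0 ≤ σ p) ∧ ∀ p, σ p = sdMap Q w c i σ p := by
  let F : (ℤ → ENNReal) →o (ℤ → ENNReal) :=
    ⟨fun σ => sdMapENN Q w c i (sdMapENN Q w c i σ),
      fun x y hxy => sdMapENN_antitone (sdMapENN_antitone hxy)⟩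
  set a := F.lfp with ha
  set b := sdMapENN Q w c i a with hb
  have hab : a = sdMapENN Q w c i b := F.map_lfp.symm
  have ha' : ∀ p, a p ≠ ⊤ := fun p => by rw [hab]; exact sdMapENN_ne_top hw _ _
  have hb' : ∀ p, b p ≠ ⊤ := fun p => sdMapENN_ne_top hw _ _
  have h1 : ∀ p, (a p).toReal = sdMap Q w c i (fun p => (b p).toReal) p := fun p => by
    conv_lhs => rw [hab]
    exact toReal_sdMapENN hc hw hb' p
  have h2 : ∀ p, (b p).toReal = sdMap Q w c i (fun p => (a p).toReal) p := fun p =>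
    toReal_sdMapENN hc hw ha' p
  have h3 : (fun p => (a p).toReal) = fun p => (b p).toReal :=
    sdMap_fixed_unique hc hw (fun p => ENNReal.toReal_nonneg) (fun p => ENNReal.toReal_nonneg)
      (Or.inr ⟨rfl, rfl⟩) h1 h2
  refine ⟨fun p => (a p).toReal, fun p => ENNReal.toReal_nonneg, fun p => ?_⟩
  conv_rhs => rw [h3]
  exact h1 p

end sdMap

/-! ### The melonic self energy -/

theorem momentumPow_nonneg (d : ℕ) (q : Fin d → ℤ) : 0 ≤ momentumPow d q :=
  Finset.sum_nonneg fun _ _ => Real.rpow_nonneg (abs_nonneg _) _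

theorem finite_sum_rpow_le {n : ℕ} {p : ℝ} (hp : 0 < p) (R : ℝ) :
    {q : Fin n → ℤ | ∑ i, |(q i : ℝ)| ^ p ≤ R}.Finite := by
  refine (Set.Finite.pi' fun _ : Fin n =>
    Set.finite_Icc (-⌈R ^ (1 / p)⌉) ⌈R ^ (1 / p)⌉).subset fun q hq i => ?_
  have h1 : |(q i : ℝ)| ^ p ≤ R :=
    (Finset.single_le_sum (f := fun i => |(q i : ℝ)| ^ p)
      (fun j _ => Real.rpow_nonneg (abs_nonneg _) _) (Finset.mem_univ i)).trans hq
  have h2 : |(q i : ℝ)| ≤ R ^ (1 / p) := by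
    have := Real.rpow_le_rpow (Real.rpow_nonneg (abs_nonneg _) _) h1 (one_div_pos.2 hp).le
    rwa [← Real.rpow_mul (abs_nonneg _), mul_one_div_cancel hp.ne', Real.rpow_one] at this
  have h3 : |(q i : ℝ)| ≤ (⌈R ^ (1 / p)⌉ : ℝ) := h2.trans (Int.le_ceil _)
  have h4 : |q i| ≤ ⌈R ^ (1 / p)⌉ := by exact_mod_cast h3
  exact abs_le.1 h4

/-- The finite set of `q ∈ ℤⁿ` with `∑ |q i|^p ≤ R`. -/
noncomputable def latticeBall (n : ℕ) {p : ℝ} (hp : 0 < p) (R : ℝ) : Finset (Fin n → ℤ) :=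
  (finite_sum_rpow_le (n := n) hp R).toFinset

@[simp] theorem mem_latticeBall {n : ℕ} {p : ℝ} {hp : 0 < p} {R : ℝ} {q : Fin n → ℤ} :
    q ∈ latticeBall n hp R ↔ ∑ i, |(q i : ℝ)| ^ p ≤ R := by
  simp [latticeBall]

theorem two_mul_eta_pos {d : ℕ} (hd : 2 ≤ d) : 0 < 2 * eta d := by
  have : (2 : ℝ) ≤ d := by exact_mod_cast hd
  rw [eta]; linarith

theorem bareCoupling_pos {d : ℕ} (hd : 2 ≤ d) {g : ℝ} (hg : 0 < g) : 0 < bareCoupling d g := by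
  have := iota_pos hd
  have : (0 : ℝ) < d := by positivity
  rw [bareCoupling]; positivity

theorem tsum_eq_sum_latticeBall {d : ℕ} (hd : 2 ≤ d) (R : ℝ) (i : Fin d) (p : ℤ)
    (f : (Fin d → ℤ) → ℝ) [∀ q : Fin d → ℤ, Decidable (q i = p ∧ momentumPow d q ≤ R)] :
    (∑' q : Fin d → ℤ, if q i = p ∧ momentumPow d q ≤ R then f q else 0) =
      ∑ q ∈ latticeBall d (two_mul_eta_pos hd) R with q i = p, f q := by
  rw [tsum_eq_sum (s := (latticeBall d (two_mul_eta_pos hd) R).filter fun q => q i = p)]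
  · refine Finset.sum_congr rfl fun q hq => if_pos ?_
    rw [Finset.mem_filter, mem_latticeBall] at hq
    exact hq.symm
  · intro q hq
    rw [if_neg]
    rw [Finset.mem_filter, mem_latticeBall] at hq
    exact fun h => hq h.symm

theorem sum_latticeBall_colour {d : ℕ} {r : ℝ} (hr : 0 < r) (R : ℝ) (i j : Fin d) (p : ℤ)
    (f : (Fin d → ℤ) → ℝ) (hf : ∀ (e : Equiv.Perm (Fin d)) q, f (q ∘ e) = f q) :
    ∑ q ∈ latticeBall d hr R with q i = p, f q = ∑ q ∈ latticeBall d hr R with q j = p, f q := by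
  refine Finset.sum_equiv (Equiv.arrowCongr (Equiv.swap i j) (Equiv.refl ℤ)) (fun q => ?_)
    (fun q _ => ?_)
  · have h : ∑ k, |((Equiv.arrowCongr (Equiv.swap i j) (Equiv.refl ℤ) q) k : ℝ)| ^ r =
        ∑ k, |(q k : ℝ)| ^ r := by
      simp only [Equiv.arrowCongr_apply, Function.comp_apply, Equiv.refl_apply]
      exact Equiv.sum_comp (Equiv.swap i j).symm (fun k => |(q k : ℝ)| ^ r)
    simp only [Finset.mem_filter, mem_latticeBall, h]
    simp
  · exact (hf (Equiv.swap i j).symm q).symm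

/-- Given the equation, positive denominators below the cutoff force `σ = -τ ≥ 0`, and conversely `σ
≥ 0` makes them positive. Permuting momentum components reduces all colours to one. -/
theorem isMelonicSelfEnergy_iff {d : ℕ} (hd : 2 ≤ d) {Λ g M : ℝ} (hΛ : 0 < Λ) (hg : 0 < g)
    (hM : 0 < M) (i₀ : Fin d) (τ : ℤ → ℝ) :
    IsMelonicSelfEnergy d Λ g M τ ↔ (∀ p, 0 ≤ -τ p) ∧ ∀ p, -τ p =
      sdMap (latticeBall d (two_mul_eta_pos hd) (Λ ^ (2 * eta d)))
        (fun q => momentumPow d q + M * Λ ^ (2 * eta d)) (2 * bareCoupling d g) i₀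
        (fun p => -τ p) p := by
  have hN := Real.rpow_pos_of_pos hΛ (2 * eta d)
  have hlam := bareCoupling_pos hd hg
  have htp : ∀ q, 1 / twoPoint d (M * Λ ^ (2 * eta d)) τ q =
      (momentumPow d q + M * Λ ^ (2 * eta d) + ∑ j, -τ (q j))⁻¹ := fun q => by
    rw [twoPoint, one_div, Finset.sum_neg_distrib, sub_eq_add_neg]
  have hw : ∀ q, 0 < momentumPow d q + M * Λ ^ (2 * eta d) := fun q =>
    add_pos_of_nonneg_of_pos (momentumPow_nonneg d q) (mul_pos hM hN)
  rw [IsMelonicSelfEnergy]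
  have hsd : ∀ i p, (τ p = -2 * bareCoupling d g *
      (∑' q : Fin d → ℤ, if q i = p ∧ momentumPow d q ≤ Λ ^ (2 * eta d)
        then 1 / twoPoint d (M * Λ ^ (2 * eta d)) τ q else 0)) ↔ -τ p =
      sdMap (latticeBall d (two_mul_eta_pos hd) (Λ ^ (2 * eta d)))
        (fun q => momentumPow d q + M * Λ ^ (2 * eta d)) (2 * bareCoupling d g) i
        (fun p => -τ p) p := by
    intro i p
    rw [tsum_eq_sum_latticeBall hd, sdMap]
    simp only [htp]
    constructor <;> intro h <;> linarith
  constructor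
  · rintro ⟨h1, h2⟩
    refine ⟨fun p => ?_, fun p => (hsd i₀ p).1 (by convert h1 i₀ p)⟩
    have h3 := (hsd i₀ p).1 (by convert h1 i₀ p)
    rw [h3, sdMap]
    refine mul_nonneg (by positivity) (Finset.sum_nonneg fun q hq => ?_)
    rw [Finset.mem_filter, mem_latticeBall] at hq
    rw [← htp]
    exact (one_div_pos.2 (h2 q hq.1)).le
  · rintro ⟨h1, h2⟩
    constructor
    · intro i p
      have h3 := (hsd i p).2 ?_
      · convert h3
      · rw [h2 p, sdMap, sdMap]
        congr 1
        refine sum_latticeBall_colour _ _ _ _ _ _ fun e q => ?_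
        congr 2
        · congr 1
          exact Equiv.sum_comp e (fun k => |(q k : ℝ)| ^ (2 * eta d))
        · exact Equiv.sum_comp e (fun k => -τ (q k))
    · intro q _
      have := sdMap_denominator_pos hw h1 q
      rw [twoPoint]
      rw [Finset.sum_neg_distrib] at this
      linarith

theorem existsUnique_isMelonicSelfEnergy {d : ℕ} (hd : 2 ≤ d) {Λ g M : ℝ} (hΛ : 0 < Λ)
    (hg : 0 < g) (hM : 0 < M) : ∃! τ : ℤ → ℝ, IsMelonicSelfEnergy d Λ g M τ := by
  have hN := Real.rpow_pos_of_pos hΛ (2 * eta d)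
  have hlam := bareCoupling_pos hd hg
  have hc : 0 < 2 * bareCoupling d g := by positivity
  have hw : ∀ q, 0 < momentumPow d q + M * Λ ^ (2 * eta d) := fun q =>
    add_pos_of_nonneg_of_pos (momentumPow_nonneg d q) (mul_pos hM hN)
  have hiff := isMelonicSelfEnergy_iff hd hΛ hg hM ⟨0, by omega⟩
  obtain ⟨σ, hσ0, hσ⟩ := exists_sdMap_fixed (Q := latticeBall d (two_mul_eta_pos hd)
    (Λ ^ (2 * eta d))) (i := ⟨0, by omega⟩) hc hw
  refine ⟨fun p => -σ p, (hiff _).2 ?_, fun τ hτ => ?_⟩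
  · simp only [neg_neg]
    exact ⟨hσ0, hσ⟩
  · obtain ⟨h1, h2⟩ := (hiff τ).1 hτ
    have h3 := sdMap_fixed_unique hc hw h1 hσ0 (Or.inl ⟨rfl, rfl⟩) h2 hσ
    funext p
    rw [← congrFun h3 p, neg_neg]

/-! ### Counting lattice points -/

theorem convex_sum_rpow_le (n : ℕ) {p : ℝ} (hp : 1 ≤ p) :
    Convex ℝ {x : Fin n → ℝ | ∑ i, |x i| ^ p ≤ 1} := by
  have h : ConvexOn ℝ Set.univ (fun x : Fin n → ℝ => ∑ i, |x i| ^ p) := by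
    refine ⟨convex_univ, fun x _ y _ a b ha hb hab => ?_⟩
    simp only [smul_eq_mul, Finset.mul_sum, ← Finset.sum_add_distrib]
    refine Finset.sum_le_sum fun i _ => ?_
    have h1 : |(a • x + b • y) i| ≤ a * |x i| + b * |y i| := by
      simp only [Pi.add_apply, Pi.smul_apply, smul_eq_mul]
      refine (abs_add_le _ _).trans_eq ?_
      rw [abs_mul, abs_mul, abs_of_nonneg ha, abs_of_nonneg hb]
    refine (Real.rpow_le_rpow (abs_nonneg _) h1 (by linarith)).trans ?_
    exact (convexOn_rpow hp).2 (abs_nonneg (x i)) (abs_nonneg (y i)) ha hb hab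
  simpa using h.convex_le 1

theorem isBounded_sum_rpow_le (n : ℕ) {p : ℝ} (hp : 0 < p) :
    Bornology.IsBounded {x : Fin n → ℝ | ∑ i, |x i| ^ p ≤ 1} := by
  refine (Metric.isBounded_closedBall (x := (0 : Fin n → ℝ)) (r := 1)).subset fun x hx => ?_
  rw [mem_closedBall_zero_iff, pi_norm_le_iff_of_nonneg zero_le_one]
  intro i
  have h1 : |x i| ^ p ≤ 1 := (Finset.single_le_sum (f := fun i => |x i| ^ p)
    (fun j _ => Real.rpow_nonneg (abs_nonneg _) _) (Finset.mem_univ i)).trans hx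
  rw [Real.norm_eq_abs]
  by_contra hcon
  exact absurd h1 (not_le.2 (Real.one_lt_rpow (not_le.1 hcon) hp))

theorem measurableSet_sum_rpow_le (n : ℕ) (p : ℝ) :
    MeasurableSet {x : Fin n → ℝ | ∑ i, |x i| ^ p ≤ 1} :=
  measurableSet_le (by fun_prop) measurable_const

theorem card_latticeBall_rpow (n : ℕ) {p : ℝ} (hp : 0 < p) {x : ℝ} (hx : 0 < x) :
    Nat.card ↑({y : Fin n → ℝ | ∑ i, |y i| ^ p ≤ 1} ∩
      x⁻¹ • (Submodule.span ℤ (Set.range (Pi.basisFun ℝ (Fin n))) : Set (Fin n → ℝ))) =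
      (latticeBall n hp (x ^ p)).card := by
  let f : (Fin n → ℤ) → (Fin n → ℝ) := fun q i => x⁻¹ * q i
  have hf : Function.Injective f := fun q q' h => by
    funext i
    have := congrFun h i
    simpa [f, hx.ne'] using this
  have himg : {y : Fin n → ℝ | ∑ i, |y i| ^ p ≤ 1} ∩
      x⁻¹ • (Submodule.span ℤ (Set.range (Pi.basisFun ℝ (Fin n))) : Set (Fin n → ℝ)) =
      f '' (latticeBall n hp (x ^ p) : Set (Fin n → ℤ)) := by
    have hsum : ∀ q : Fin n → ℤ, (∑ i, |f q i| ^ p ≤ 1 ↔ ∑ i, |(q i : ℝ)| ^ p ≤ x ^ p) := by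
      intro q
      have : ∀ i, |f q i| ^ p = (x ^ p)⁻¹ * |(q i : ℝ)| ^ p := fun i => by
        rw [abs_mul, abs_of_pos (inv_pos.2 hx),
          Real.mul_rpow (inv_pos.2 hx).le (abs_nonneg _), Real.inv_rpow hx.le]
      simp only [this]
      rw [← Finset.mul_sum, inv_mul_le_iff₀ (Real.rpow_pos_of_pos hx p), mul_one]
    ext y
    constructor
    · rintro ⟨hy1, z, hz, rfl⟩
      rw [SetLike.mem_coe, Module.Basis.mem_span_iff_repr_mem] at hz
      choose q hq using hz
      have hfq : f q = x⁻¹ • z := by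
        funext i
        have := hq i
        simp only [Pi.basisFun_repr, algebraMap_int_eq, eq_intCast] at this
        simp [f, this]
      refine ⟨q, ?_, hfq⟩
      rw [Finset.mem_coe, mem_latticeBall, ← hsum, hfq]
      exact hy1
    · rintro ⟨q, hq, rfl⟩
      rw [Finset.mem_coe, mem_latticeBall] at hq
      refine ⟨(hsum q).2 hq, fun i => q i, ?_, by funext i; simp [f]⟩
      rw [SetLike.mem_coe, Module.Basis.mem_span_iff_repr_mem]
      exact fun i => ⟨q i, by simp⟩
  rw [himg, Nat.card_coe_set_eq, Set.ncard_image_of_injective _ hf, Set.ncard_coe_finset]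

/-- For `p = n / 2` the denominator `Γ(n / p + 1)` of the ball volume is `Γ(3) = 2`, whence the
factor one half. -/
theorem volume_sum_rpow_le_one {n : ℕ} (hn : 2 ≤ n) :
    MeasureTheory.volume.real {x : Fin n → ℝ | ∑ i, |x i| ^ (2 * eta (n + 1)) ≤ 1} =
      iota (n + 1) / 2 := by
  have hn' : (2 : ℝ) ≤ n := by exact_mod_cast hn
  have hp : 2 * eta (n + 1) = n / 2 := by rw [eta]; push_cast; ring
  have : Nonempty (Fin n) := ⟨⟨0, by omega⟩⟩
  have h := MeasureTheory.volume_sum_rpow_le (Fin n) (p := 2 * eta (n + 1)) (by rw [hp]; linarith) 1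
  have hset : {x : Fin n → ℝ | (∑ i, |x i| ^ (2 * eta (n + 1))) ^ (1 / (2 * eta (n + 1))) ≤ 1} =
      {x : Fin n → ℝ | ∑ i, |x i| ^ (2 * eta (n + 1)) ≤ 1} := by
    ext x
    have h0 : 0 ≤ ∑ i, |x i| ^ (2 * eta (n + 1)) :=
      Finset.sum_nonneg fun _ _ => Real.rpow_nonneg (abs_nonneg _) _
    have h1 := Real.rpow_le_rpow_iff h0 zero_le_one (z := 1 / (2 * eta (n + 1)))
      (by rw [hp]; positivity)
    rwa [Real.one_rpow] at h1
  rw [hset] at h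
  rw [MeasureTheory.measureReal_def, h]
  have h3 : (n : ℝ) / (2 * eta (n + 1)) + 1 = 2 + 1 := by rw [hp]; field_simp
  have h4 : 1 / (2 * eta (n + 1)) + 1 = (((n + 1 : ℕ) : ℝ) + 1) / (((n + 1 : ℕ) : ℝ) - 1) := by
    have hn0 : (n : ℝ) ≠ 0 := by positivity
    rw [hp]; push_cast; rw [add_sub_cancel_right]; field_simp; ring
  have h5 : Real.Gamma (2 + 1) = 2 := by
    have := Real.Gamma_nat_eq_factorial 2
    norm_num at this ⊢
  rw [Fintype.card_fin, h3, h4, h5, ENNReal.ofReal_one, one_pow, one_mul, ENNReal.toReal_ofReal,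
    mul_pow]
  · rfl
  · have h6 : 0 < (((n + 1 : ℕ) : ℝ) + 1) / (((n + 1 : ℕ) : ℝ) - 1) := by
      push_cast; rw [add_sub_cancel_right]; positivity
    have := Real.Gamma_pos_of_pos h6
    positivity

/-- The points are those of a shrinking lattice in a fixed body, with mesh `R^{-1/p}`, and `n / p =
2` gives the power `R²`. The body is convex since `p ≥ 1`, so its frontier is null; its dilates are
nested, which allows a real scaling parameter. -/
theorem tendsto_card_latticeBall {n : ℕ} (hn : 2 ≤ n) (hp : 0 < 2 * eta (n + 1)) :
    Tendsto (fun R : ℝ => ((latticeBall n hp R).card : ℝ) / R ^ 2) atTop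
      (𝓝 (iota (n + 1) / 2)) := by
  have hn' : (2 : ℝ) ≤ n := by exact_mod_cast hn
  have hpn : 2 * eta (n + 1) = n / 2 := by rw [eta]; push_cast; ring
  have hp1 : 1 ≤ 2 * eta (n + 1) := by rw [hpn]; linarith
  have h := tendsto_card_div_pow_atTop_volume' {x : Fin n → ℝ | ∑ i, |x i| ^ (2 * eta (n + 1)) ≤ 1}
    (isBounded_sum_rpow_le n hp) (measurableSet_sum_rpow_le n _)
    ((convex_sum_rpow_le n hp1).addHaar_frontier _) ?_
  · rw [volume_sum_rpow_le_one hn, Fintype.card_fin] at h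
    have h2 := h.comp (tendsto_rpow_atTop (one_div_pos.2 hp))
    refine h2.congr' ?_
    filter_upwards [eventually_gt_atTop 0] with R hR
    have hR' := Real.rpow_pos_of_pos hR (1 / (2 * eta (n + 1)))
    simp only [Function.comp_apply]
    rw [card_latticeBall_rpow n hp hR', ← Real.rpow_mul hR.le, one_div_mul_cancel hp.ne',
      Real.rpow_one, ← Real.rpow_natCast (R ^ (1 / (2 * eta (n + 1)))), ← Real.rpow_mul hR.le,
      show 1 / (2 * eta (n + 1)) * (n : ℝ) = (2 : ℕ) by rw [hpn]; push_cast; field_simp,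
      Real.rpow_natCast]
  · rintro x y hx hxy _ ⟨z, hz, rfl⟩
    have hy : 0 < y := hx.trans_le hxy
    refine ⟨(x / y) • z, ?_, ?_⟩
    · refine le_trans (Finset.sum_le_sum fun i _ => ?_)
        (show ∑ i, |z i| ^ (2 * eta (n + 1)) ≤ 1 from hz)
      refine Real.rpow_le_rpow (abs_nonneg _) ?_ hp.le
      rw [Pi.smul_apply, smul_eq_mul, abs_mul, abs_of_pos (div_pos hx hy)]
      exact mul_le_of_le_one_left (abs_nonneg _) ((div_le_one hy).2 hxy)
    · simp only [smul_smul]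
      rw [mul_div_cancel₀ _ hy.ne']

theorem tendsto_card_latticeBall_mul {n : ℕ} (hn : 2 ≤ n) (hp : 0 < 2 * eta (n + 1)) {s : ℝ}
    (hs : 0 < s) :
    Tendsto (fun N : ℝ => ((latticeBall n hp (s * N)).card : ℝ) / N ^ 2) atTop
      (𝓝 (s ^ 2 * (iota (n + 1) / 2))) := by
  have h := ((tendsto_card_latticeBall hn hp).comp (tendsto_id.const_mul_atTop hs)).const_mul (s ^ 2)
  refine h.congr fun N => ?_
  simp only [Function.comp_apply, id]
  rw [mul_pow]
  field_simp

theorem latticeBall_mono {n : ℕ} {p : ℝ} (hp : 0 < p) {R R' : ℝ} (h : R ≤ R') :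
    latticeBall n hp R ⊆ latticeBall n hp R' := fun q hq => by
  rw [mem_latticeBall] at hq ⊢
  exact hq.trans h

/-! ### Layer-cake summation over lattice balls -/

theorem hasDerivAt_neg_inv_add {u s : ℝ} (h : s + u ≠ 0) :
    HasDerivAt (fun s : ℝ => -(s + u)⁻¹) ((s + u) ^ 2)⁻¹ s := by
  refine (((hasDerivAt_id s).add_const u).inv h).neg.congr_deriv ?_
  simp only [id]
  field_simp

theorem integral_layer {u r : ℝ} (hu : 0 < u) (hr0 : 0 ≤ r) (hr1 : r ≤ 1) :
    IntervalIntegrable (fun s => if r ≤ s then ((s + u) ^ 2)⁻¹ else 0)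
      MeasureTheory.volume 0 1 ∧
    ∫ s in (0 : ℝ)..1, (if r ≤ s then ((s + u) ^ 2)⁻¹ else 0) = (r + u)⁻¹ - (1 + u)⁻¹ := by
  have hpos : ∀ s, 0 ≤ s → s + u ≠ 0 := fun s hs => by positivity
  have h1 : IntervalIntegrable (fun s => ((s + u) ^ 2)⁻¹) MeasureTheory.volume r 1 := by
    refine ContinuousOn.intervalIntegrable fun s hs => ContinuousAt.continuousWithinAt ?_
    rw [Set.uIcc_of_le hr1] at hs
    have := hpos s (hr0.trans hs.1)
    fun_prop (disch := positivity)
  have e1 : Set.EqOn (fun _ : ℝ => (0 : ℝ)) (fun s => if r ≤ s then ((s + u) ^ 2)⁻¹ else 0)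
      (Set.uIoo 0 r) := fun s hs => by
    rw [Set.uIoo_of_le hr0] at hs
    simp only [if_neg (not_le.2 hs.2)]
  have e2 : Set.EqOn (fun s => ((s + u) ^ 2)⁻¹)
      (fun s => if r ≤ s then ((s + u) ^ 2)⁻¹ else 0) (Set.uIoo r 1) := fun s hs => by
    rw [Set.uIoo_of_le hr1] at hs
    simp only [if_pos hs.1.le]
  have i1 : IntervalIntegrable (fun s => if r ≤ s then ((s + u) ^ 2)⁻¹ else 0)
      MeasureTheory.volume 0 r :=
    (intervalIntegrable_const (c := (0 : ℝ))).congr_uIoo e1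
  have i2 : IntervalIntegrable (fun s => if r ≤ s then ((s + u) ^ 2)⁻¹ else 0)
      MeasureTheory.volume r 1 := h1.congr_uIoo e2
  refine ⟨i1.trans i2, ?_⟩
  rw [← intervalIntegral.integral_add_adjacent_intervals i1 i2,
    ← intervalIntegral.integral_congr_uIoo e1, ← intervalIntegral.integral_congr_uIoo e2,
    intervalIntegral.integral_eq_sub_of_hasDerivAt (f := fun s : ℝ => -(s + u)⁻¹) _ h1]
  · simp only [intervalIntegral.integral_zero]; ring
  · intro s hs
    rw [Set.uIcc_of_le hr1] at hs
    exact hasDerivAt_neg_inv_add (hpos s (hr0.trans hs.1))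

theorem integral_sq_div_two_mul_inv_sq {u : ℝ} (hu : 0 < u) :
    ∫ s in (0 : ℝ)..1, s ^ 2 / 2 * ((s + u) ^ 2)⁻¹ =
      1 - u * Real.log ((1 + u) / u) - 1 / 2 * (1 + u)⁻¹ := by
  have hpos : ∀ s, 0 ≤ s → s + u ≠ 0 := fun s hs => by positivity
  have hint : IntervalIntegrable (fun s => s ^ 2 / 2 * ((s + u) ^ 2)⁻¹)
      MeasureTheory.volume 0 1 := by
    refine ContinuousOn.intervalIntegrable fun s hs => ContinuousAt.continuousWithinAt ?_
    rw [Set.uIcc_of_le zero_le_one] at hs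
    have := hpos s hs.1
    fun_prop (disch := positivity)
  rw [intervalIntegral.integral_eq_sub_of_hasDerivAt
    (f := fun s : ℝ => 1 / 2 * s - u * Real.log (s + u) + u ^ 2 / 2 * -(s + u)⁻¹) _ hint]
  · rw [Real.log_div (by positivity) hu.ne']
    field_simp
    simp
    ring
  · intro s hs
    rw [Set.uIcc_of_le zero_le_one] at hs
    have h := hpos s hs.1
    have hd := ((((hasDerivAt_id s).const_mul (1 / 2 : ℝ)).sub
      ((((hasDerivAt_id s).add_const u).log h).const_mul u)).add
      ((hasDerivAt_neg_inv_add h).const_mul (u ^ 2 / 2)))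
    refine hd.congr_deriv ?_
    simp only [id]
    field_simp
    ring

/-- Each summand is `(r + u)⁻¹ = (1 + u)⁻¹ + ∫_r^1 (s + u)⁻² ds`; exchanging sum and integral counts
the points with `r ≤ s`. The sum thus depends only on cardinalities. -/
theorem sum_latticeBall_inv_eq {n : ℕ} {p : ℝ} (hp : 0 < p) {N u : ℝ} (hN : 0 < N) (hu : 0 < u) :
    ∑ q ∈ latticeBall n hp N, ((∑ i, |(q i : ℝ)| ^ p) / N + u)⁻¹ =
      (latticeBall n hp N).card * (1 + u)⁻¹ +
        ∫ s in (0 : ℝ)..1, ((latticeBall n hp (s * N)).card : ℝ) * ((s + u) ^ 2)⁻¹ := by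
  have hr : ∀ q ∈ latticeBall n hp N, 0 ≤ (∑ i, |(q i : ℝ)| ^ p) / N ∧
      (∑ i, |(q i : ℝ)| ^ p) / N ≤ 1 := fun q hq => by
    rw [mem_latticeBall] at hq
    exact ⟨div_nonneg (Finset.sum_nonneg fun _ _ => Real.rpow_nonneg (abs_nonneg _) _) hN.le,
      (div_le_one hN).2 hq⟩
  have hint : ∫ s in (0 : ℝ)..1, ((latticeBall n hp (s * N)).card : ℝ) * ((s + u) ^ 2)⁻¹ =
      ∫ s in (0 : ℝ)..1, ∑ q ∈ latticeBall n hp N,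
        (if (∑ i, |(q i : ℝ)| ^ p) / N ≤ s then ((s + u) ^ 2)⁻¹ else 0) := by
    refine intervalIntegral.integral_congr fun s hs => ?_
    rw [Set.uIcc_of_le zero_le_one] at hs
    have hfil : latticeBall n hp (s * N) =
        (latticeBall n hp N).filter fun q => (∑ i, |(q i : ℝ)| ^ p) / N ≤ s := by
      ext q
      simp only [Finset.mem_filter, mem_latticeBall, div_le_iff₀ hN]
      refine ⟨fun h => ⟨h.trans (mul_le_of_le_one_left hN.le hs.2), h⟩, fun h => h.2⟩
    simp only [hfil]
    rw [← Finset.sum_filter, Finset.sum_const, nsmul_eq_mul]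
  rw [hint, intervalIntegral.integral_finsetSum fun q hq =>
    (integral_layer hu (hr q hq).1 (hr q hq).2).1, ← nsmul_eq_mul, ← Finset.sum_const,
    ← Finset.sum_add_distrib]
  refine Finset.sum_congr rfl fun q hq => ?_
  rw [(integral_layer hu (hr q hq).1 (hr q hq).2).2]
  ring

theorem tendsto_sum_latticeBall_inv {n : ℕ} (hn : 2 ≤ n) (hp : 0 < 2 * eta (n + 1)) {u : ℝ}
    (hu : 0 < u) :
    Tendsto (fun N : ℝ => (∑ q ∈ latticeBall n hp N,
      ((∑ i, |(q i : ℝ)| ^ (2 * eta (n + 1))) / N + u)⁻¹) / N ^ 2) atTop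
      (𝓝 (iota (n + 1) * (1 - u * Real.log ((1 + u) / u)))) := by
  have hcard := tendsto_card_latticeBall hn hp
  have hlim : Tendsto (fun N : ℝ => ((latticeBall n hp N).card : ℝ) / N ^ 2 * (1 + u)⁻¹ +
      ∫ s in (0 : ℝ)..1, ((latticeBall n hp (s * N)).card : ℝ) / N ^ 2 * ((s + u) ^ 2)⁻¹) atTop
      (𝓝 (iota (n + 1) / 2 * (1 + u)⁻¹ +
        ∫ s in (0 : ℝ)..1, s ^ 2 * (iota (n + 1) / 2) * ((s + u) ^ 2)⁻¹)) := by
    refine (hcard.mul_const _).add ?_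
    -- On `s ≤ 1` the count is at most that of the full ball, eventually at most `(ι / 2 + 1) N²`,
    -- and `(s + u)⁻² ≤ u⁻²`.
    refine intervalIntegral.tendsto_integral_filter_of_dominated_convergence
      (fun _ => (iota (n + 1) / 2 + 1) * (u ^ 2)⁻¹) ?_ ?_ intervalIntegrable_const ?_
    · filter_upwards [eventually_gt_atTop 0] with N hN
      have hmono : Monotone fun s : ℝ => ((latticeBall n hp (s * N)).card : ℝ) := fun s t hst =>
        Nat.cast_le.2 (Finset.card_le_card
          (latticeBall_mono hp (mul_le_mul_of_nonneg_right hst hN.le)))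
      have h1 := hmono.measurable
      exact Measurable.aestronglyMeasurable (by fun_prop)
    · filter_upwards [eventually_gt_atTop 0,
        hcard.eventually_le_const (lt_add_one (iota (n + 1) / 2))] with N hN hle
      refine Eventually.of_forall fun s hs => ?_
      rw [Set.uIoc_of_le zero_le_one] at hs
      rw [Real.norm_of_nonneg (by positivity)]
      refine mul_le_mul (le_trans ?_ hle) ?_ (by positivity)
        (le_trans (by positivity) hle)
      · gcongr
        exact latticeBall_mono hp (mul_le_of_le_one_left hN.le hs.2)
      · have := hs.1
        gcongr
        linarith
    · refine Eventually.of_forall fun s hs => ?_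
      rw [Set.uIoc_of_le zero_le_one] at hs
      exact (tendsto_card_latticeBall_mul hn hp hs.1).mul_const _
  have hval : iota (n + 1) / 2 * (1 + u)⁻¹ +
        ∫ s in (0 : ℝ)..1, s ^ 2 * (iota (n + 1) / 2) * ((s + u) ^ 2)⁻¹ =
      iota (n + 1) * (1 - u * Real.log ((1 + u) / u)) := by
    have : ∀ s : ℝ, s ^ 2 * (iota (n + 1) / 2) * ((s + u) ^ 2)⁻¹ =
        iota (n + 1) * (s ^ 2 / 2 * ((s + u) ^ 2)⁻¹) := fun s => by ring
    simp only [this]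
    rw [intervalIntegral.integral_const_mul, integral_sq_div_two_mul_inv_sq hu]
    ring
  rw [hval] at hlim
  refine hlim.congr' ?_
  filter_upwards [eventually_gt_atTop 0] with N hN
  rw [sum_latticeBall_inv_eq hp hN hu, add_div, ← intervalIntegral.integral_div]
  congr 1
  · ring
  · refine intervalIntegral.integral_congr fun s _ => ?_
    ring

/-! ### The large rank limit of the effective mass -/

theorem sum_latticeBall_slice {n : ℕ} {p : ℝ} (hp : 0 < p) (R : ℝ) (P : ℤ)
    (f : (Fin (n + 1) → ℤ) → ℝ) :
    ∑ q ∈ latticeBall (n + 1) hp R with q 0 = P, f q =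
      ∑ q ∈ latticeBall n hp (R - |(P : ℝ)| ^ p), f (Fin.cons P q) := by
  symm
  refine Finset.sum_bij (fun q _ => Fin.cons P q) (fun q hq => ?_) (fun q _ q' _ h => ?_)
    (fun q hq => ?_) (fun q _ => rfl)
  · rw [mem_latticeBall] at hq
    rw [Finset.mem_filter, mem_latticeBall, Fin.sum_univ_succ]
    simp only [Fin.cons_zero, Fin.cons_succ, and_true]
    linarith
  · exact Fin.cons_right_injective (α := fun _ => ℤ) P h
  · rw [Finset.mem_filter, mem_latticeBall, Fin.sum_univ_succ] at hq
    refine ⟨Fin.tail q, ?_, ?_⟩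
    · rw [mem_latticeBall, ← hq.2]
      simp only [Fin.tail]
      linarith [hq.1]
    · rw [← hq.2]
      exact Fin.cons_self_tail q

/-- The Schwinger-Dyson equation for `σ = -τ` after resolving the momentum constraint. -/
def IsSliceSolution (n : ℕ) {p : ℝ} (hp : 0 < p) (N μ c : ℝ) (σ : ℤ → ℝ) : Prop :=
  (∀ P, 0 ≤ σ P) ∧ ∀ P, σ P = c * ∑ q ∈ latticeBall n hp (N - |(P : ℝ)| ^ p),
    (|(P : ℝ)| ^ p + ∑ j, |(q j : ℝ)| ^ p + μ + (σ P + ∑ j, σ (q j)))⁻¹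

theorem IsMelonicSelfEnergy.isSliceSolution {n : ℕ} (hn : 1 ≤ n) (hp : 0 < 2 * eta (n + 1))
    {Λ g M : ℝ} (hΛ : 0 < Λ) (hg : 0 < g) (hM : 0 < M) {τ : ℤ → ℝ}
    (h : IsMelonicSelfEnergy (n + 1) Λ g M τ) :
    IsSliceSolution n hp (Λ ^ (2 * eta (n + 1))) (M * Λ ^ (2 * eta (n + 1)))
      (2 * bareCoupling (n + 1) g) (fun P => -τ P) := by
  obtain ⟨h1, h2⟩ := (isMelonicSelfEnergy_iff (by omega) hΛ hg hM 0 τ).1 h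
  refine ⟨h1, fun P => ?_⟩
  refine (h2 P).trans ?_
  rw [sdMap, sum_latticeBall_slice]
  simp only [momentumPow, Fin.sum_univ_succ, Fin.cons_zero, Fin.cons_succ]

namespace IsSliceSolution

variable {n : ℕ} {p : ℝ} {hp : 0 < p} {N μ c : ℝ} {σ : ℤ → ℝ}

theorem sum_nonneg (h : IsSliceSolution n hp N μ c σ) (q : Fin n → ℤ) : 0 ≤ ∑ j, σ (q j) :=
  Finset.sum_nonneg fun j _ => h.1 (q j)

theorem zero_eq (h : IsSliceSolution n hp N μ c σ) :
    σ 0 = c * ∑ q ∈ latticeBall n hp N, (∑ j, |(q j : ℝ)| ^ p + μ + (σ 0 + ∑ j, σ (q j)))⁻¹ := by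
  have h0 : |((0 : ℤ) : ℝ)| ^ p = 0 := by simp [hp.ne']
  conv_lhs => rw [h.2 0]
  simp only [h0, sub_zero, zero_add]

theorem sum_rpow_nonneg (p : ℝ) (q : Fin n → ℤ) : 0 ≤ ∑ j, |(q j : ℝ)| ^ p :=
  Finset.sum_nonneg fun _ _ => Real.rpow_nonneg (abs_nonneg _) _

/-- If `σ P > σ 0`, the sum at `P` would run over a smaller ball with larger denominators, hence be
at most the sum at `0`. -/
theorem le_zero (h : IsSliceSolution n hp N μ c σ) (hμ : 0 < μ) (hc : 0 < c) (P : ℤ) :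
    σ P ≤ σ 0 := by
  by_contra hcon
  push Not at hcon
  refine absurd ?_ (not_le.2 hcon)
  have hy : 0 ≤ |(P : ℝ)| ^ p := Real.rpow_nonneg (abs_nonneg _) _
  rw [h.2 P, h.zero_eq]
  refine mul_le_mul_of_nonneg_left ?_ hc.le
  have hpos : ∀ q : Fin n → ℤ, 0 < ∑ j, |(q j : ℝ)| ^ p + μ + (σ 0 + ∑ j, σ (q j)) := fun q => by
    have := h.sum_nonneg q
    have := h.1 0
    have := sum_rpow_nonneg p q
    positivity
  refine (Finset.sum_le_sum fun q _ => ?_).trans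
    (Finset.sum_le_sum_of_subset_of_nonneg (latticeBall_mono hp (by linarith))
      fun q _ _ => (inv_pos.2 (hpos q)).le)
  exact inv_anti₀ (hpos q) (by linarith)

theorem zero_le_card (h : IsSliceSolution n hp N μ c σ) (hμ : 0 < μ) (hc : 0 < c) :
    σ 0 ≤ c * ((latticeBall n hp N).card / μ) := by
  rw [h.zero_eq, div_eq_mul_inv, ← nsmul_eq_mul, ← Finset.sum_const]
  refine mul_le_mul_of_nonneg_left (Finset.sum_le_sum fun q _ => inv_anti₀ hμ ?_) hc.le
  linarith [h.sum_nonneg q, h.1 0, sum_rpow_nonneg p q]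

/-- The first term counts the lattice points lost in the outer shell, the second bounds the shift of
the denominators by `|P|^p ≤ δ N`. Replacing `σ P` by the larger `σ 0` is harmless for a lower bound
on `σ P`. -/
theorem zero_sub_le (h : IsSliceSolution n hp N μ c σ) (hμ : 0 < μ) (hc : 0 < c) {δ : ℝ} {P : ℤ}
    (hP : |(P : ℝ)| ^ p ≤ δ * N) :
    σ 0 - σ P ≤ c * (((latticeBall n hp N).card - (latticeBall n hp ((1 - δ) * N)).card) / μ +
      (latticeBall n hp N).card * (δ * N) / μ ^ 2) := by
  set y := |(P : ℝ)| ^ p with hydef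
  have hy : 0 ≤ y := Real.rpow_nonneg (abs_nonneg _) _
  set A : (Fin n → ℤ) → ℝ := fun q => ∑ j, |(q j : ℝ)| ^ p + μ + (σ 0 + ∑ j, σ (q j)) with hA
  have hAμ : ∀ q, μ ≤ A q := fun q => by
    simp only [hA]; linarith [h.sum_nonneg q, h.1 0, sum_rpow_nonneg p q]
  have hsub : latticeBall n hp (N - y) ⊆ latticeBall n hp N := latticeBall_mono hp (by linarith)
  have hsub' : latticeBall n hp ((1 - δ) * N) ⊆ latticeBall n hp (N - y) :=
    latticeBall_mono hp (by linarith)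
  have h1 : c * ∑ q ∈ latticeBall n hp (N - y), (A q + y)⁻¹ ≤ σ P := by
    rw [h.2 P]
    refine mul_le_mul_of_nonneg_left (Finset.sum_le_sum fun q _ => ?_) hc.le
    refine inv_anti₀ ?_ ?_
    · have := h.sum_nonneg q
      have := h.1 P
      have := sum_rpow_nonneg p q
      positivity
    · simp only [hA]
      linarith [h.le_zero hμ hc P]
  have h2 : ∑ q ∈ latticeBall n hp (N - y), (A q)⁻¹ ≤
      ∑ q ∈ latticeBall n hp (N - y), (A q + y)⁻¹ +
        (latticeBall n hp N).card * (δ * N) / μ ^ 2 := by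
    have : ∑ q ∈ latticeBall n hp (N - y), (A q)⁻¹ ≤
        ∑ q ∈ latticeBall n hp (N - y), ((A q + y)⁻¹ + δ * N / μ ^ 2) := by
      refine Finset.sum_le_sum fun q _ => ?_
      have hApos := hμ.trans_le (hAμ q)
      have e1 : (A q)⁻¹ - (A q + y)⁻¹ = y / (A q * (A q + y)) := by field_simp; ring
      have e2 : y / (A q * (A q + y)) ≤ δ * N / μ ^ 2 := by
        refine div_le_div₀ (hy.trans hP) hP (by positivity) ?_
        rw [sq]
        exact mul_le_mul (hAμ q) (by linarith [hAμ q]) hμ.le hApos.le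
      linarith
    refine this.trans ?_
    rw [Finset.sum_add_distrib, Finset.sum_const, nsmul_eq_mul,
      mul_div_assoc ((latticeBall n hp N).card : ℝ)]
    have hcard : ((latticeBall n hp (N - y)).card : ℝ) ≤ (latticeBall n hp N).card :=
      Nat.cast_le.2 (Finset.card_le_card hsub)
    have := hy.trans hP
    gcongr
  have h3 : ∑ q ∈ latticeBall n hp N \ latticeBall n hp (N - y), (A q)⁻¹ ≤
      ((latticeBall n hp N).card - (latticeBall n hp ((1 - δ) * N)).card) / μ := by
    refine (Finset.sum_le_sum fun q _ => inv_anti₀ hμ (hAμ q)).trans ?_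
    rw [Finset.sum_const, nsmul_eq_mul, Finset.card_sdiff_of_subset hsub,
      Nat.cast_sub (Finset.card_le_card hsub), ← div_eq_mul_inv]
    have hcard : ((latticeBall n hp ((1 - δ) * N)).card : ℝ) ≤ (latticeBall n hp (N - y)).card :=
      Nat.cast_le.2 (Finset.card_le_card hsub')
    gcongr
  have h4 := Finset.sum_sdiff (f := fun q => (A q)⁻¹) hsub
  have h5 : σ 0 = c * ∑ q ∈ latticeBall n hp N, (A q)⁻¹ := h.zero_eq
  calc σ 0 - σ P ≤ c * ∑ q ∈ latticeBall n hp N, (A q)⁻¹ -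
        c * ∑ q ∈ latticeBall n hp (N - y), (A q + y)⁻¹ := by rw [← h5]; linarith
    _ = c * (∑ q ∈ latticeBall n hp N, (A q)⁻¹ -
        ∑ q ∈ latticeBall n hp (N - y), (A q + y)⁻¹) := by ring
    _ ≤ _ := mul_le_mul_of_nonneg_left (by linarith) hc.le

/-- Few components of a momentum below the cutoff are large, so that the self energy of every
such momentum is close to that of the zero momentum. -/
theorem sum_zero_sub_le (h : IsSliceSolution n hp N μ c σ) (hN : 0 < N)
    {δ K₁ K₂ : ℝ} (hδ : 0 < δ) (hK₁ : 0 ≤ K₁)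
    (h1 : ∀ P : ℤ, |(P : ℝ)| ^ p ≤ δ * N → σ 0 - σ P ≤ K₁) (h2 : σ 0 ≤ K₂)
    {q : Fin n → ℤ} (hq : q ∈ latticeBall n hp N) :
    n * σ 0 - ∑ j, σ (q j) ≤ n * K₁ + K₂ / δ := by
  rw [mem_latticeBall] at hq
  have hK₂ : 0 ≤ K₂ := (h.1 0).trans h2
  -- A Markov-type bound: a large component costs at most `K₂`, paid for by its share of the total
  -- `∑ |q_j|^p ≤ N`.
  have hterm : ∀ j, σ 0 - σ (q j) ≤ K₁ + K₂ / (δ * N) * |(q j : ℝ)| ^ p := by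
    intro j
    have hy : 0 ≤ |(q j : ℝ)| ^ p := Real.rpow_nonneg (abs_nonneg _) _
    have hδN : 0 < δ * N := mul_pos hδ hN
    rcases le_total (|(q j : ℝ)| ^ p) (δ * N) with hle | hle
    · have : 0 ≤ K₂ / (δ * N) * |(q j : ℝ)| ^ p := by positivity
      linarith [h1 _ hle]
    · have : K₂ ≤ K₂ / (δ * N) * |(q j : ℝ)| ^ p := by
        rw [div_mul_eq_mul_div, le_div_iff₀ hδN]
        exact mul_le_mul_of_nonneg_left hle hK₂
      linarith [h.1 (q j)]
  calc n * σ 0 - ∑ j, σ (q j) = ∑ j, (σ 0 - σ (q j)) := by simp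
    _ ≤ ∑ j, (K₁ + K₂ / (δ * N) * |(q j : ℝ)| ^ p) := Finset.sum_le_sum fun j _ => hterm j
    _ = n * K₁ + K₂ / (δ * N) * ∑ j, |(q j : ℝ)| ^ p := by
        rw [Finset.sum_add_distrib, ← Finset.mul_sum]; simp
    _ ≤ n * K₁ + K₂ / (δ * N) * N := by gcongr
    _ = n * K₁ + K₂ / δ := by field_simp

theorem sum_inv_le_zero (h : IsSliceSolution n hp N μ c σ) (hμ : 0 < μ) (hc : 0 < c) (hN : 0 < N)
    {v : ℝ} (hv : μ + (n + 1) * σ 0 ≤ N * v) :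
    c * ((∑ q ∈ latticeBall n hp N, ((∑ j, |(q j : ℝ)| ^ p) / N + v)⁻¹) / N) ≤ σ 0 := by
  conv_rhs => rw [h.zero_eq]
  refine mul_le_mul_of_nonneg_left ?_ hc.le
  rw [Finset.sum_div]
  refine Finset.sum_le_sum fun q _ => ?_
  have h1 := sum_rpow_nonneg p q
  have h2 := h.sum_nonneg q
  have h3 := h.1 0
  have h4 : ∑ j, σ (q j) ≤ n * σ 0 := by
    calc ∑ j, σ (q j) ≤ ∑ _j : Fin n, σ 0 := Finset.sum_le_sum fun j _ => h.le_zero hμ hc _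
      _ = n * σ 0 := by simp
  rw [div_eq_mul_inv, ← mul_inv]
  refine inv_anti₀ (by positivity) ?_
  rw [add_mul, div_mul_cancel₀ _ hN.ne']
  linarith

theorem zero_le_sum_inv (h : IsSliceSolution n hp N μ c σ) (hc : 0 < c) (hN : 0 < N)
    {v E : ℝ} (hv0 : 0 < v) (hv : N * v ≤ μ + (n + 1) * σ 0 - E)
    (hE : ∀ q ∈ latticeBall n hp N, n * σ 0 - ∑ j, σ (q j) ≤ E) :
    σ 0 ≤ c * ((∑ q ∈ latticeBall n hp N, ((∑ j, |(q j : ℝ)| ^ p) / N + v)⁻¹) / N) := by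
  conv_lhs => rw [h.zero_eq]
  refine mul_le_mul_of_nonneg_left ?_ hc.le
  rw [Finset.sum_div]
  refine Finset.sum_le_sum fun q hq => ?_
  have h1 := sum_rpow_nonneg p q
  rw [div_eq_mul_inv, ← mul_inv]
  refine inv_anti₀ (by positivity) ?_
  rw [add_mul, div_mul_cancel₀ _ hN.ne']
  linarith [hE q hq]

end IsSliceSolution

/-- Lattice sums are evaluated only at the fixed mass `v`, whose limit is known from the mass
equation. Monotonicity of the inverse in the mass turns each one-sided deviation of size `ε` into a
contradiction, so no convergence of the effective mass is presupposed. -/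
theorem eventually_abs_effectiveMass_sub_lt {g M v ε : ℝ} (hg : 0 < g) (hM : 0 < M) (hv : 0 < v)
    (hε : 0 < ε) (hveq : v = (M + 2 * g) - 2 * g * v * Real.log ((1 + v) / v)) :
    ∀ᶠ d : ℕ in atTop, ∀ᶠ Λ : ℝ in atTop, ∀ τ : ℤ → ℝ, IsMelonicSelfEnergy d Λ g M τ →
      |melonicEffectiveMass d Λ M τ - v| < ε := by
  -- `C δ` bounds the relative error from small components and `2g / (d M δ)` that from large ones.
  -- Hence `δ` is chosen first, then `d`, each error being at most `ε / 2`.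
  set C := 2 * g * (1 / M + 1 / M ^ 2) with hC
  have hCpos : 0 < C := by positivity
  obtain ⟨δ, hδ, hδC⟩ : ∃ δ : ℝ, 0 < δ ∧ δ < 1 ∧ C * δ ≤ ε / 2 := by
    refine ⟨min (1 / 2) (ε / 2 / C), by positivity, (min_le_left _ _).trans_lt (by norm_num), ?_⟩
    have := min_le_right (1 / 2) (ε / 2 / C)
    rwa [le_div_iff₀' hCpos] at this
  have hdlim := (tendsto_const_div_rank_mul (2 * g) (M * δ)).eventually_le_const
    (show (0 : ℝ) < ε / 2 by positivity)
  filter_upwards [eventually_ge_atTop 4, hdlim] with d hd hdε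
  obtain ⟨n, rfl⟩ : ∃ n, d = n + 1 := ⟨d - 1, by omega⟩
  have hp : 0 < 2 * eta (n + 1) := two_mul_eta_pos (by omega)
  have hι : 0 < iota (n + 1) := iota_pos (by omega)
  have hcpos := mul_pos two_pos (bareCoupling_pos (d := n + 1) (by omega) hg)
  have hdpos : (0 : ℝ) < (n + 1 : ℕ) := by positivity
  have hcι : ((n + 1 : ℕ) : ℝ) * (2 * bareCoupling (n + 1) g) = 2 * g / iota (n + 1) := by
    rw [bareCoupling]; field_simp
  have hNlim := tendsto_rpow_atTop hp
  have hcard := tendsto_card_latticeBall (n := n) (by omega) hp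
  have hcard' := hcard.sub (tendsto_card_latticeBall_mul (n := n) (by omega) hp
    (s := 1 - δ) (by linarith))
  have e1 := hcard.eventually_le_const (show iota (n + 1) / 2 < iota (n + 1) by linarith)
  -- The shell has limiting density `ι (1 - (1 - δ)²) / 2 = ι (δ - δ² / 2)`, strictly below `ι δ`.
  have e2 := hcard'.eventually_le_const
    (show iota (n + 1) / 2 - (1 - δ) ^ 2 * (iota (n + 1) / 2) < iota (n + 1) * δ by
      nlinarith [mul_pos hι (pow_pos hδ 2)])
  have hΦ := ((tendsto_sum_latticeBall_inv (n := n) (by omega) hp hv).const_mul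
    (2 * g / iota (n + 1))).const_add M
  have hval : M + 2 * g / iota (n + 1) *
      (iota (n + 1) * (1 - v * Real.log ((1 + v) / v))) = v := by
    conv_rhs => rw [hveq]
    field_simp
    ring
  rw [hval] at hΦ
  have e3 := hΦ.eventually_lt_const (show v < v + ε by linarith)
  have e4 := hΦ.eventually_const_lt (show v - ε < v by linarith)
  filter_upwards [eventually_gt_atTop 0, hNlim.eventually e1, hNlim.eventually e2,
    hNlim.eventually e3, hNlim.eventually e4] with Λ hΛ c1 c2 c3 c4 τ hτ
  have h := hτ.isSliceSolution (by omega) hp hΛ hg hM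
  rw [melonicEffectiveMass]
  have hN := Real.rpow_pos_of_pos hΛ (2 * eta (n + 1))
  set N := Λ ^ (2 * eta (n + 1))
  set c := 2 * bareCoupling (n + 1) g
  have hμ : 0 < M * N := mul_pos hM hN
  set s := -τ 0 with hs
  have hs0 : 0 ≤ s := h.1 0
  have hd1 : ((n + 1 : ℕ) : ℝ) = n + 1 := by push_cast; ring
  set Φ := ∑ q ∈ latticeBall n hp N, ((∑ i, |(q i : ℝ)| ^ (2 * eta (n + 1))) / N + v)⁻¹ with hΦdef
  have hscale : ∀ x : ℝ, (n + 1 : ℕ) * (c * (x / N)) / N = 2 * g / iota (n + 1) * (x / N ^ 2) := by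
    intro x
    rw [← hcι]; field_simp
  rw [show M - ((n + 1 : ℕ) : ℝ) * τ 0 / N = M + ((n + 1 : ℕ) : ℝ) * s / N by rw [hs]; ring]
  have hu : N * (M + ((n + 1 : ℕ) : ℝ) * s / N) = M * N + (n + 1) * s := by
    rw [← hd1]; field_simp
  rw [abs_lt]
  constructor
  · by_contra hcon
    have hle : M + ((n + 1 : ℕ) : ℝ) * s / N ≤ v := by linarith
    have h1 := h.sum_inv_le_zero hμ hcpos hN (v := v)
      (by rw [← hu]; exact mul_le_mul_of_nonneg_left hle hN.le)
    have h2 : ((n + 1 : ℕ) : ℝ) * (c * (Φ / N)) / N ≤ ((n + 1 : ℕ) : ℝ) * s / N := by gcongr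
    rw [hscale] at h2
    linarith
  · by_contra hcon
    have hb1 : ∀ P : ℤ, |(P : ℝ)| ^ (2 * eta (n + 1)) ≤ δ * N →
        s - -τ P ≤ c * (iota (n + 1) * N * (δ * (1 / M + 1 / M ^ 2))) := by
      intro P hP
      refine (h.zero_sub_le hμ hcpos hP).trans (mul_le_mul_of_nonneg_left ?_ hcpos.le)
      rw [← sub_div, div_le_iff₀ (by positivity)] at c2
      rw [div_le_iff₀ (by positivity)] at c1
      calc _ ≤ iota (n + 1) * δ * N ^ 2 / (M * N) +
            iota (n + 1) * N ^ 2 * (δ * N) / (M * N) ^ 2 := by gcongr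
        _ = _ := by field_simp
    have hb2 : s ≤ c * (iota (n + 1) * N / M) := by
      refine (h.zero_le_card hμ hcpos).trans (mul_le_mul_of_nonneg_left ?_ hcpos.le)
      rw [div_le_iff₀ (by positivity)] at c1
      calc _ ≤ iota (n + 1) * N ^ 2 / (M * N) := by gcongr
        _ = _ := by field_simp
    have hE : ∀ q ∈ latticeBall n hp N, n * s - ∑ j, -τ (q j) ≤ ε * N := by
      intro q hq
      refine (h.sum_zero_sub_le hN hδ (by positivity) hb1 hb2 hq).trans ?_
      have hcval : c * iota (n + 1) = 2 * g / (n + 1 : ℕ) := by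
        rw [eq_div_iff hdpos.ne', mul_right_comm, mul_comm c, hcι]; field_simp
      have t1 : (n : ℝ) * (c * (iota (n + 1) * N * (δ * (1 / M + 1 / M ^ 2)))) ≤ ε / 2 * N := by
        calc (n : ℝ) * (c * (iota (n + 1) * N * (δ * (1 / M + 1 / M ^ 2))))
            = (n : ℝ) * ((c * iota (n + 1)) * (N * (δ * (1 / M + 1 / M ^ 2)))) := by ring
          _ ≤ ((n + 1 : ℕ) : ℝ) * ((c * iota (n + 1)) * (N * (δ * (1 / M + 1 / M ^ 2)))) := by
              gcongr; omega
          _ = C * δ * N := by rw [hcval, hC]; field_simp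
          _ ≤ ε / 2 * N := by gcongr; exact hδC.2
      have t2 : c * (iota (n + 1) * N / M) / δ ≤ ε / 2 * N := by
        calc c * (iota (n + 1) * N / M) / δ = c * iota (n + 1) * (N / M / δ) := by ring
          _ = 2 * g / ((n + 1 : ℕ) * (M * δ)) * N := by rw [hcval]; field_simp
          _ ≤ ε / 2 * N := by gcongr
      linarith
    -- The assumed excess `ε` absorbs the error `ε N` in every denominator, so the sum at mass `v`
    -- still dominates.
    have hle : v ≤ M + ((n + 1 : ℕ) : ℝ) * s / N - ε := by linarith
    have h1 := h.zero_le_sum_inv hcpos hN hv (E := ε * N) (by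
      have := mul_le_mul_of_nonneg_left hle hN.le
      rw [mul_sub, hu] at this
      linarith) hE
    have h2 : ((n + 1 : ℕ) : ℝ) * s / N ≤ ((n + 1 : ℕ) : ℝ) * (c * (Φ / N)) / N := by gcongr
    rw [hscale] at h2
    linarith

theorem uStar_lower_massEquation {g M : ℝ} (hg : 0 < g) (hM : 0 < M) :
    uStar .lower g M = (M + 2 * g) -
      2 * g * uStar .lower g M * Real.log ((1 + uStar .lower g M) / uStar .lower g M) :=
  ((massEquation_iff hg.ne').2
    ⟨.lower, interior_subset (Delta_mem_interior_lower hg hM), rfl⟩).2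

end MelonicTGFT

theorem mainTheorem5 :
    -- the melonic sector at positive coupling and mass, and its limit (`Λ → ∞`, then `d → ∞`)
    (∀ g M : ℝ, 0 < g → 0 < M →
      (∀ d : ℕ, 4 ≤ d → ∀ Λ : ℝ, 0 < Λ →
        ∃! τ : ℤ → ℝ, MelonicTGFT.IsMelonicSelfEnergy d Λ g M τ) ∧
      (g, M) ∈ MelonicTGFT.interiorRegion MelonicTGFT.LambertBranch.lower ∧
      ∀ ε : ℝ, 0 < ε → ∀ᶠ d : ℕ in Filter.atTop, ∀ᶠ Λ : ℝ in Filter.atTop,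
        ∀ τ : ℤ → ℝ, MelonicTGFT.IsMelonicSelfEnergy d Λ g M τ →
          |MelonicTGFT.melonicEffectiveMass d Λ M τ -
            MelonicTGFT.uStar MelonicTGFT.LambertBranch.lower g M| < ε) ∧
    -- the two branches are exactly the real solutions of the resummed large rank mass equation
    (∀ g M u : ℝ, g ≠ 0 →
      (((0 < u ∨ u < -1) ∧ u = (M + 2 * g) - 2 * g * u * Real.log ((1 + u) / u)) ↔
        ∃ k : MelonicTGFT.LambertBranch,
          MelonicTGFT.Delta g M ∈ MelonicTGFT.lambertDomain k ∧
            u = MelonicTGFT.uStar k g M)) ∧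
    -- `1 + W` vanishes only at the boundary point `-1/e`
    (∀ (k : MelonicTGFT.LambertBranch) (x : ℝ), x ∈ MelonicTGFT.lambertDomain k →
      MelonicTGFT.lambertW k x * Real.exp (MelonicTGFT.lambertW k x) = x ∧
        (1 + MelonicTGFT.lambertW k x = 0 ↔ x = -Real.exp (-1))) ∧
    ∀ k : MelonicTGFT.LambertBranch,
      -- `u⋆` is a differentiable function, so the Callan-Symanzik equations make sense
      (∀ x ∈ MelonicTGFT.interiorRegion k,
        DifferentiableAt ℝ (fun y : ℝ × ℝ => MelonicTGFT.uStar k y.1 y.2) x) ∧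
      -- the large rank beta functions where the anomalous dimension vanishes
      (∀ g M : ℝ, (g, M) ∈ MelonicTGFT.interiorRegion k → ∀ B b : ℝ,
        (MelonicTGFT.IsLargeRankBeta k (fun _ => 0) g M B b ↔
          b = g * Real.exp (MelonicTGFT.lambertW k (MelonicTGFT.Delta g M) +
                MelonicTGFT.expo g M) *
              (1 + MelonicTGFT.lambertW k (MelonicTGFT.Delta g M)) ∧
          B = 2 * g ^ 3 / (1 + M) ^ 2 *
              Real.exp (MelonicTGFT.lambertW k (MelonicTGFT.Delta g M) +
                MelonicTGFT.expo g M) *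
              (1 + MelonicTGFT.lambertW k (MelonicTGFT.Delta g M)))) ∧
      -- no fixed point, hence no isolated one
      MelonicTGFT.largeRankFixedPoints k = ∅ ∧
      ∀ x : ℝ × ℝ, ¬ MelonicTGFT.IsIsolatedPoint (MelonicTGFT.largeRankFixedPoints k) x := by
  refine ⟨fun g M hg hM => ⟨fun d hd Λ hΛ =>
      MelonicTGFT.existsUnique_isMelonicSelfEnergy (by omega) hΛ hg hM,
      MelonicTGFT.mem_interiorRegion_lower hg hM, fun ε hε =>
      MelonicTGFT.eventually_abs_effectiveMass_sub_lt hg hM (MelonicTGFT.uStar_lower_pos hg hM) hε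
        (MelonicTGFT.uStar_lower_massEquation hg hM)⟩,
    fun g M u hg => MelonicTGFT.massEquation_iff hg,
    fun k x hx => ⟨MelonicTGFT.lambertW_mul_exp hx, MelonicTGFT.one_add_lambertW_eq_zero_iff hx⟩,
    fun k => ⟨fun x hx => MelonicTGFT.differentiableAt_uStar hx,
      fun g M hx B b => MelonicTGFT.isLargeRankBeta_zero_iff hx B b,
      MelonicTGFT.largeRankFixedPoints_eq_empty k, fun x hx => ?_⟩⟩
  have h := hx.1
  rw [MelonicTGFT.largeRankFixedPoints_eq_empty k] at h
  exact h
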